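/- **Setting.** Let $H$ be a real Hilbert space with inner product $(\cdot,\cdot)_H$. For $k\in L^1_{\rm loc}([0,\infty))$ and a function $w$ write $(k*w)(t)=\int_0^t k(t-s)\,w(s)\,ds$. Assume that $k$ satisfies (K): $k\in L^1_{\rm loc}([0,\infty))$ is nonnegative and nonincreasing on $(0,\infty)$, and there is a nonnegative and nonincreasing kernel $\ell\in L^1_{\rm loc}([0,\infty))$ (a *conjugate kernel* of $k$) such that $(k*\ell)(t)=1$ for all $t>0$. Let $\varphi:H\to(-\infty,\infty]$ be a proper (i.e. $\varphi\not\equiv\infty$) lower-semicontinuous convex functional, $D(\varphi)=\{w\in H:\varphi(w)<\infty\}$, and for $z\in D(\varphi)$ let $\partial\varphi(z)=\{\xi\in H:\varphi(v)-\varphi(z)\ge(\xi,v-z)_H\ \text{for all } v\in D(\varphi)\}$ be its subdifferential, with domain $D(\partial\varphi)=\{w\in D(\varphi):\partial\varphi(w)\neq\emptyset\}$. **Proposition 4.2 (Integral forms of fractional chain-rule formulae).** Let $T\in(0,\infty)$, $u_0\in D(\varphi)$, and let $u\in L^2(0,T;H)$ be such that - $k*(u-u_0)\in W^{1,2}(0,T;H)$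 and $[k*(u-u_0)](0)=0$ (in the sense of the continuous representative on $[0,T]$), - $u(t)\in D(\partial\varphi)$ for a.e. $t\in(0,T)$. Assume that $g\in L^2(0,T;H)$ satisfies $g(t)\in\partial\varphi(u(t))$ for a.e. $t\in(0,T)$. Then $\varphi(u(\cdot))\in L^1(0,T)$ and $\left(\frac{d}{dt}[k*(u-u_0)],g\right)_H\in L^1(0,T)$ (so that the convolutions below converge absolutely for a.e. $t\in(0,T)$), and the following hold. (i) For a.e. $t\in(0,T)$, $$\int_0^t\left(\frac{d}{dt}[k*(u-u_0)](\tau),\,g(\tau)\right)_H d\tau\ \ge\ \left[k*\big(\varphi(u(\cdot))-\varphi(u_0)\big)\right](t).$$ (ii) For every conjugate kernel $\ell$ of $k$ and for a.e. $t\in(0,T)$, $$\left[\ell*\left(\frac{d}{dt}[k*(u-u_0)](\cdot),\,g(\cdot)\right)_H\right](t)\ \ge\ \varphi(u(t))-\varphi(u_0).$$ -/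

import Mathlib

open MeasureTheory Set
open scoped ContDiff

noncomputable section

namespace FracFlow

/-! ### Kernels and convolution on the half-line -/

section Convolution

variable {X : Type*} [NormedAddCommGroup X] [NormedSpace ℝ X]

/-- `(k * w)(t) = ∫₀ᵗ k(t - s) w(s) ds`. -/
def conv (k : ℝ → ℝ) (w : ℝ → X) (t : ℝ) : X :=
  ∫ s in (0 : ℝ)..t, k (t - s) • w s

/-- The integral defining `(k * w)(t)` converges absolutely. -/
def ConvExists (k : ℝ → ℝ) (w : ℝ → X) (t : ℝ) : Prop :=
  IntervalIntegrable (fun s => k (t - s) • w s) volume 0 t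

end Convolution

/-- A nonnegative, nonincreasing kernel in `L¹_loc([0,∞))`. The value at the single point `0`
plays no role (the kernel may blow up there). -/
structure IsKernel (k : ℝ → ℝ) : Prop where
  locallyIntegrable : LocallyIntegrableOn k (Ici 0)
  nonneg : ∀ t, 0 < t → 0 ≤ k t
  antitone : AntitoneOn k (Ioi 0)

/-- `ℓ` is a conjugate kernel of `k`: an admissible kernel with `k * ℓ = 1` on `(0,∞)`. -/
structure IsConjugateKernel (k ℓ : ℝ → ℝ) : Prop where
  isKernel : IsKernel ℓ
  conv_eq_one : ∀ t, 0 < t → conv k ℓ t = 1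

/-- Assumption (K) on the kernel `k`. -/
def AssumptionK (k : ℝ → ℝ) : Prop :=
  IsKernel k ∧ ∃ ℓ : ℝ → ℝ, IsConjugateKernel k ℓ

/-! ### The space `W^{1,2}(0,T;X)` -/

section Sobolev

variable {X : Type*} [NormedAddCommGroup X] [NormedSpace ℝ X]

/-- `w ∈ L²(0,T;X)`. -/
def MemL2 (T : ℝ) (w : ℝ → X) : Prop :=
  MemLp w 2 (volume.restrict (Ioo 0 T))

/-- `v` is the weak derivative of `w` on `(0,T)`:
`∫₀ᵀ ζ'(t) w(t) dt = - ∫₀ᵀ ζ(t) v(t) dt` for every `ζ ∈ C_c^∞(0,T)`. -/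
def IsWeakDeriv (T : ℝ) (w v : ℝ → X) : Prop :=
  ∀ ζ : ℝ → ℝ, ContDiff ℝ ∞ ζ → HasCompactSupport ζ → tsupport ζ ⊆ Ioo 0 T →
    ∫ t in Ioo 0 T, deriv ζ t • w t = - ∫ t in Ioo 0 T, ζ t • v t

/-- `w ∈ W^{1,2}(0,T;X)` and `dw/dt = v` (an a.e. determined element of `L²(0,T;X)`). -/
structure IsW12WithDeriv (T : ℝ) (w v : ℝ → X) : Prop where
  memL2 : MemL2 T w
  memL2_deriv : MemL2 T v
  weakDeriv : IsWeakDeriv T w v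

/-- `w(0) = 0` for (the class of) a function on `(0,T)` with a representative that is continuous
on `[0,T]`, as every element of `W^{1,2}(0,T;X)` has: that representative vanishes at `0`. -/
def VanishesAtZero (T : ℝ) (w : ℝ → X) : Prop :=
  ∃ W : ℝ → X, ContinuousOn W (Icc 0 T) ∧ W =ᵐ[volume.restrict (Ioo 0 T)] w ∧ W 0 = 0

end Sobolev

/-! ### Convex functionals with values in `(-∞,∞]` and subdifferentials -/

section Subdifferential

variable {H : Type*} [NormedAddCommGroup H] [InnerProductSpace ℝ H]

/-- The effective domain `D(φ) = {w | φ(w) < ∞}`. -/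
def effDom (φ : H → EReal) : Set H := {w | φ w < ⊤}

/-- A proper lower-semicontinuous convex functional `φ : H → (-∞,∞]`. -/
structure IsProperLscConvex (φ : H → EReal) : Prop where
  ne_bot : ∀ w, φ w ≠ ⊥
  proper : (effDom φ).Nonempty
  lsc : LowerSemicontinuous φ
  convex : ∀ (x y : H) (a b : ℝ), 0 < a → 0 < b → a + b = 1 →
    φ (a • x + b • y) ≤ (a : EReal) * φ x + (b : EReal) * φ y

/-- The subdifferential
`∂φ(z) = {ξ | φ(v) - φ(z) ≥ (ξ, v - z) for all v ∈ D(φ)}` for `z ∈ D(φ)`, and `∅` otherwise. -/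
def subdiff (φ : H → EReal) (z : H) : Set H :=
  {ξ | z ∈ effDom φ ∧ ∀ v ∈ effDom φ, ((inner ℝ ξ (v - z) : ℝ) : EReal) ≤ φ v - φ z}

/-- The domain `D(∂φ) = {w ∈ D(φ) | ∂φ(w) ≠ ∅}`. -/
def subdiffDom (φ : H → EReal) : Set H := {w | w ∈ effDom φ ∧ (subdiff φ w).Nonempty}

end Subdifferential

end FracFlow

end

noncomputable section

namespace FracFlow

/-! ### Convolution on `(0,T)` through truncation to the whole line. -/

section ConvBasics

variable {X : Type*} [NormedAddCommGroup X] [NormedSpace ℝ X]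

/-! Put `w = u - u₀`, `F = φ(u) - φ(u₀)` and `v = d/dt[k * w]`. Convolving `k * w = 1 * v` with `ℓ`
and using `k * ℓ = 1` gives `w = ℓ * v` (`ae_eq_conv_conjugate`). It remains to prove `F ≤ ℓ * (v,
g)`, which is (ii); convolving with `k ≥ 0` then gives (i).

Convexity enters only through subgradient inequalities, which survive averaging. Let `h ≥ 0` have
mass at most one. Integrating `F(t) - F(s) ≤ (w(t) - w(s), g(t))` against `h(t - s) ds`, and giving
the missing mass to `F(t) ≤ (w(t), g(t))`, yields `F - h * F ≤ (w - h * w, g)`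
(`sub_conv_le_inner`). Since `w = ℓ * v`, the right side is `(κ * v, g)` with `κ = ℓ - ℓ * h`.
Convolving with `ℓ ≥ 0` gives `κ * F ≤ ℓ * (κ * v, g)` (`conv_le_conv_inner`). If multiples `c κ`
form an approximate identity, the claim follows in the limit.

Ideally `ℓ * h` would be the tail `q = ℓ 1_{[ε,∞)}`, so that `κ` would be the head of `ℓ`,
concentrated on `(0,ε)`. That `h` is the derivative of `k * q`, which is nondecreasing because `k`
is nonincreasing, but it may be only a measure. A difference quotient of step `δ` makes it a
function and replaces `q` by its average over `(0,δ)` (`exists_subprobability`). The error `q - ρ_δ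
* q` tends to `0` in `L¹` as `δ → 0` with `ε` fixed, so first `ε` and then `δ` is chosen small
(`exists_approximate_identity`). No differentiability of `k` is needed. -/

open ContinuousLinearMap in
lemma conv_integrand_indicator {T t : ℝ} (ht : t ∈ Ioo 0 T) (a : ℝ → ℝ) (f : ℝ → X) :
    (fun s => lsmul ℝ ℝ ((Ioo 0 T).indicator a (t - s)) ((Ioo 0 T).indicator f s))
      = (Ioo 0 t).indicator (fun s => a (t - s) • f s) := by
  obtain ⟨h0, h1⟩ := ht
  ext s
  simp only [lsmul_apply, indicator_apply, mem_Ioo]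
  by_cases h : 0 < s ∧ s < t
  · rw [if_pos ⟨by linarith, by linarith⟩, if_pos ⟨h.1, by linarith⟩, if_pos h]
  · rw [if_neg h]
    by_cases h' : 0 < s
    · rw [if_neg fun h2 => h ⟨h', by linarith [h2.1]⟩, zero_smul]
    · rw [if_neg (c := 0 < s ∧ s < T) fun h2 => h' h2.1, smul_zero]

/-- On `(0,T)`, the half-line convolution is the convolution of the truncations to `(0,T)`. -/
lemma conv_eq_convolution {T t : ℝ} (ht : t ∈ Ioo 0 T) (a : ℝ → ℝ) (f : ℝ → X) :
    conv a f t = convolution ((Ioo 0 T).indicator a) ((Ioo 0 T).indicator f)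
      (ContinuousLinearMap.lsmul ℝ ℝ) volume t := by
  rw [convolution_eq_swap, conv_integrand_indicator ht, integral_indicator measurableSet_Ioo,
    conv, intervalIntegral.integral_of_le ht.1.le, integral_Ioc_eq_integral_Ioo]

/-- For `0 < s < t < T` both `s` and `t - s` lie in `(0,T)`, so truncating the factors changes
nothing. This makes the theory of `convolution` for integrable functions on the line available. -/
lemma convExists_iff {T t : ℝ} (ht : t ∈ Ioo 0 T) (a : ℝ → ℝ) (f : ℝ → X) :
    ConvExists a f t ↔ ConvolutionExistsAt ((Ioo 0 T).indicator a) ((Ioo 0 T).indicator f) t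
      (ContinuousLinearMap.lsmul ℝ ℝ) volume := by
  rw [convolutionExistsAt_iff_integrable_swap, conv_integrand_indicator ht,
    integrable_indicator_iff measurableSet_Ioo, ConvExists,
    intervalIntegrable_iff_integrableOn_Ioo_of_le ht.1.le]

variable {T : ℝ} {a b c : ℝ → ℝ} {f g : ℝ → X}

lemma ae_convExists (ha : IntegrableOn a (Ioo 0 T)) (hf : IntegrableOn f (Ioo 0 T)) :
    ∀ᵐ t ∂(volume.restrict (Ioo 0 T)), ConvExists a f t := by
  have h := Integrable.ae_convolution_exists (ContinuousLinearMap.lsmul ℝ ℝ)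
    (ha.integrable_indicator measurableSet_Ioo) (hf.integrable_indicator measurableSet_Ioo)
  filter_upwards [ae_restrict_of_ae h, ae_restrict_mem measurableSet_Ioo] with t h1 h2
  exact (convExists_iff h2 a f).2 h1

lemma integrableOn_conv (ha : IntegrableOn a (Ioo 0 T)) (hf : IntegrableOn f (Ioo 0 T)) :
    IntegrableOn (conv a f) (Ioo 0 T) := by
  have h := Integrable.integrable_convolution (ContinuousLinearMap.lsmul ℝ ℝ)
    (ha.integrable_indicator measurableSet_Ioo) (hf.integrable_indicator measurableSet_Ioo)
  refine h.integrableOn.congr_fun (fun t ht => ?_) measurableSet_Ioo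
  exact (conv_eq_convolution ht a f).symm

lemma conv_congr (hab : a =ᵐ[volume.restrict (Ioo 0 T)] b)
    (hfg : f =ᵐ[volume.restrict (Ioo 0 T)] g) {t : ℝ} (ht : t ∈ Ioo 0 T) :
    conv a f t = conv b g t := by
  rw [conv_eq_convolution ht, conv_eq_convolution ht]
  exact congrFun (convolution_congr _ ((ae_eq_restrict_iff_indicator_ae_eq measurableSet_Ioo).1 hab)
    ((ae_eq_restrict_iff_indicator_ae_eq measurableSet_Ioo).1 hfg)) t

lemma conv_ae_congr (hab : a =ᵐ[volume.restrict (Ioo 0 T)] b)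
    (hfg : f =ᵐ[volume.restrict (Ioo 0 T)] g) :
    conv a f =ᵐ[volume.restrict (Ioo 0 T)] conv b g := by
  filter_upwards [ae_restrict_mem measurableSet_Ioo] with t ht using conv_congr hab hfg ht

lemma conv_comm (a b : ℝ → ℝ) : conv a b = conv b a := by
  ext t
  have := intervalIntegral.integral_comp_sub_left (fun s => b (t - s) * a s) t (a := 0) (b := t)
  simp only [sub_zero, sub_self, sub_sub_cancel] at this
  simp only [conv, smul_eq_mul, ← this]
  exact intervalIntegral.integral_congr fun s _ => mul_comm _ _

lemma indicator_conv (a : ℝ → ℝ) (f : ℝ → X) :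
    (Ioo 0 T).indicator (conv a f) =  (Ioo 0 T).indicator
      (convolution ((Ioo 0 T).indicator a) ((Ioo 0 T).indicator f)
      (ContinuousLinearMap.lsmul ℝ ℝ) volume) :=
  indicator_congr fun _ ht => conv_eq_convolution ht a f

-- An inner convolution arrives truncated to `(0,T)`. The truncation must be removed before
-- `convolution_assoc` applies; it is harmless because only arguments below `T` are met.
open ContinuousLinearMap in
lemma indicator_convolution_left {t : ℝ} (ht : t ∈ Ioo 0 T) {p : ℝ → ℝ}
    (hp : ∀ s ≤ 0, p s = 0) (f : ℝ → X) :
    convolution ((Ioo 0 T).indicator p) ((Ioo 0 T).indicator f) (lsmul ℝ ℝ) volume t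
     = convolution p ((Ioo 0 T).indicator f) (lsmul ℝ ℝ) volume t := by
  rw [convolution_eq_swap, convolution_eq_swap]
  congr 1; ext s
  by_cases hs : s ∈ Ioo 0 T
  · by_cases h : t - s ≤ 0
    · rw [hp _ h, indicator_of_notMem fun h' => h.not_gt h'.1]
    · rw [indicator_of_mem (s := Ioo 0 T) (a := t - s) ]
      simp only [mem_Ioo] at *; constructor <;> linarith
  · simp [hs]

open ContinuousLinearMap in
lemma indicator_convolution_right {t : ℝ} (ht : t ∈ Ioo 0 T) (a : ℝ → ℝ) {p : ℝ → X}
    (hp : ∀ s ≤ 0, p s = 0) :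
    convolution ((Ioo 0 T).indicator a) ((Ioo 0 T).indicator p) (lsmul ℝ ℝ) volume t
     = convolution ((Ioo 0 T).indicator a) p (lsmul ℝ ℝ) volume t := by
  rw [convolution_def, convolution_def]
  congr 1; ext s
  by_cases hs : s ∈ Ioo 0 T
  · by_cases h : t - s ≤ 0
    · rw [hp _ h, indicator_of_notMem (a := t - s) fun h' => h.not_gt h'.1]
    · rw [indicator_of_mem (s := Ioo 0 T) (a := t - s) ]
      simp only [mem_Ioo] at *; constructor <;> linarith
  · simp [hs]

open ContinuousLinearMap in
lemma convolution_indicator_of_nonpos (a : ℝ → ℝ) (f : ℝ → X) {t : ℝ} (ht : t ≤ 0) :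
    convolution ((Ioo 0 T).indicator a) ((Ioo 0 T).indicator f) (lsmul ℝ ℝ) volume t = 0 := by
  rw [convolution_def]
  refine integral_eq_zero_of_ae (Filter.Eventually.of_forall fun s => ?_)
  by_cases hs : s ∈ Ioo 0 T
  · have : t - s ∉ Ioo 0 T := by simp only [mem_Ioo] at *; intro h; linarith [h.1, hs.1]
    simp [this]
  · simp [hs]

/-- Fubini for the triple convolution. It needs `|a| * (|b| * |f|)` to converge at `t`, which holds
only for a.e. `t`. -/
lemma conv_assoc [CompleteSpace X] (ha : IntegrableOn a (Ioo 0 T)) (hb : IntegrableOn b (Ioo 0 T))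
    (hf : IntegrableOn f (Ioo 0 T)) :
    conv (conv a b) f =ᵐ[volume.restrict (Ioo 0 T)] conv a (conv b f) := by
  have ha' := ha.integrable_indicator measurableSet_Ioo
  have hb' := hb.integrable_indicator measurableSet_Ioo
  have hf' := hf.integrable_indicator measurableSet_Ioo
  have h1 := (hb'.norm.integrable_convolution (ContinuousLinearMap.mul ℝ ℝ) hf'.norm)
  have h2 := ha'.norm.ae_convolution_exists (ContinuousLinearMap.mul ℝ ℝ) h1
  filter_upwards [ae_restrict_of_ae h2, ae_restrict_mem measurableSet_Ioo] with t h3 ht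
  rw [conv_eq_convolution ht, conv_eq_convolution ht, indicator_conv, indicator_conv,
    indicator_convolution_left ht fun s hs => convolution_indicator_of_nonpos _ _ hs,
    indicator_convolution_right ht _ fun s hs => convolution_indicator_of_nonpos _ _ hs]
  refine convolution_assoc (ContinuousLinearMap.lsmul ℝ ℝ) (ContinuousLinearMap.lsmul ℝ ℝ)
    (ContinuousLinearMap.lsmul ℝ ℝ) (ContinuousLinearMap.lsmul ℝ ℝ) (fun x y z => ?_) ha'.1 hb'.1 hf'.1
    (ha'.ae_convolution_exists _ hb') (hb'.norm.ae_convolution_exists _ hf'.norm) h3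
  simp only [ContinuousLinearMap.lsmul_apply, smul_eq_mul, mul_smul]

lemma ConvExists.conv_sub_right {t : ℝ} (h1 : ConvExists a f t) (h2 : ConvExists a g t) :
    conv a (fun s => f s - g s) t = conv a f t - conv a g t := by
  simp only [conv, smul_sub]
  exact intervalIntegral.integral_sub h1 h2

lemma ConvExists.conv_sub_left {t : ℝ} (h1 : ConvExists a f t) (h2 : ConvExists b f t) :
    conv (fun s => a s - b s) f t = conv a f t - conv b f t := by
  simp only [conv, sub_smul]
  exact intervalIntegral.integral_sub h1 h2

lemma conv_sub_right (ha : IntegrableOn a (Ioo 0 T)) (hf : IntegrableOn f (Ioo 0 T))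
    (hg : IntegrableOn g (Ioo 0 T)) :
    conv a (fun s => f s - g s) =ᵐ[volume.restrict (Ioo 0 T)] fun t => conv a f t - conv a g t := by
  filter_upwards [ae_convExists ha hf, ae_convExists ha hg] with t h1 h2
    using h1.conv_sub_right h2

lemma conv_sub_left (ha : IntegrableOn a (Ioo 0 T)) (hb : IntegrableOn b (Ioo 0 T))
    (hf : IntegrableOn f (Ioo 0 T)) :
    conv (fun s => a s - b s) f =ᵐ[volume.restrict (Ioo 0 T)]
      fun t => conv a f t - conv b f t := by
  filter_upwards [ae_convExists ha hf, ae_convExists hb hf] with t h1 h2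
    using h1.conv_sub_left h2

lemma conv_const_mul_left (r : ℝ) (a : ℝ → ℝ) (f : ℝ → X) (t : ℝ) :
    conv (fun s => r * a s) f t = r • conv a f t := by
  simp only [conv, mul_smul]
  exact intervalIntegral.integral_smul _ _

lemma conv_const_mul_right (r : ℝ) (a b : ℝ → ℝ) (t : ℝ) :
    conv a (fun s => r * b s) t = r * conv a b t := by
  rw [conv_comm, conv_const_mul_left, conv_comm, smul_eq_mul]

lemma ae_restrict_Ioo_sub_left {p : ℝ → Prop} (hp : ∀ᵐ s ∂(volume.restrict (Ioo 0 T)), p s)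
    {t : ℝ} (ht : t ∈ Ioo 0 T) : ∀ᵐ s ∂(volume.restrict (Ioo 0 t)), p (t - s) := by
  rw [ae_restrict_iff' measurableSet_Ioo] at hp ⊢
  filter_upwards [(quasiMeasurePreserving_sub_left_of_right_invariant volume t).ae hp] with s hs h
  exact hs ⟨by linarith [h.2], by linarith [h.1, ht.2]⟩

lemma ae_restrict_Ioo_of_mem {p : ℝ → Prop} (hp : ∀ᵐ s ∂(volume.restrict (Ioo 0 T)), p s)
    {t : ℝ} (ht : t ∈ Ioo 0 T) : ∀ᵐ s ∂(volume.restrict (Ioo 0 t)), p s :=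
  ae_mono (Measure.restrict_mono (Ioo_subset_Ioo_right ht.2.le) le_rfl) hp

lemma conv_eq_setIntegral {t : ℝ} (ht : 0 ≤ t) (a : ℝ → ℝ) (f : ℝ → X) :
    conv a f t = ∫ s in Ioo 0 t, a (t - s) • f s := by
  rw [conv, intervalIntegral.integral_of_le ht, integral_Ioc_eq_integral_Ioo]

lemma convExists_iff_integrableOn {t : ℝ} (ht : 0 ≤ t) (a : ℝ → ℝ) (f : ℝ → X) :
    ConvExists a f t ↔ IntegrableOn (fun s => a (t - s) • f s) (Ioo 0 t) := by
  rw [ConvExists, intervalIntegrable_iff_integrableOn_Ioo_of_le ht]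

lemma conv_mono (ha : IntegrableOn a (Ioo 0 T)) (hb : IntegrableOn b (Ioo 0 T))
    (hc : IntegrableOn c (Ioo 0 T)) (ha0 : ∀ᵐ s ∂(volume.restrict (Ioo 0 T)), 0 ≤ a s)
    (hbc : ∀ᵐ s ∂(volume.restrict (Ioo 0 T)), b s ≤ c s) :
    ∀ᵐ t ∂(volume.restrict (Ioo 0 T)), conv a b t ≤ conv a c t := by
  filter_upwards [ae_convExists ha hb, ae_convExists ha hc, ae_restrict_mem measurableSet_Ioo]
    with t h1 h2 ht
  rw [convExists_iff_integrableOn ht.1.le] at h1 h2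
  rw [conv_eq_setIntegral ht.1.le, conv_eq_setIntegral ht.1.le]
  refine integral_mono_ae h1 h2 ?_
  filter_upwards [ae_restrict_Ioo_sub_left ha0 ht, ae_restrict_Ioo_of_mem hbc ht] with s h3 h4
  exact mul_le_mul_of_nonneg_left h4 h3

lemma conv_one_left (f : ℝ → X) (t : ℝ) : conv (fun _ => 1) f t = ∫ s in (0 : ℝ)..t, f s := by
  simp [conv]

end ConvBasics

/-! ### Young's inequality and approximate identities, tested against a dual function. -/

section ApproximateIdentity

open Filter Topology
open scoped ENNReal

variable {X : Type*} [NormedAddCommGroup X] {Y : Type*} [NormedAddCommGroup Y]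

/-- Translations act continuously on `Lp` for `p < ∞`. -/
lemma tendsto_eLpNorm_sub_translate {p : ℝ≥0∞} (hp1 : 1 ≤ p) (hp : p ≠ ⊤) {F : ℝ → X}
    (hF : MemLp F p volume) :
    Tendsto (fun s : ℝ => eLpNorm (fun t => F t - F (t - s)) p volume) (𝓝 0) (𝓝 0) := by
  have : Fact (1 ≤ p) := ⟨hp1⟩
  have : Fact (p ≠ ⊤) := ⟨hp⟩
  have hc : Continuous fun s : ℝ => edist (hF.toLp F) (DomAddAct.mk (-s) +ᵥ hF.toLp F) := by
    refine Continuous.edist continuous_const ?_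
    exact (DomAddAct.continuous_mk.comp continuous_neg).vadd continuous_const
  have h0 := hc.tendsto 0
  have hz : DomAddAct.mk (-(0 : ℝ)) +ᵥ hF.toLp F = hF.toLp F := by
    rw [neg_zero, show DomAddAct.mk (0 : ℝ) = 0 from rfl, zero_vadd]
  simp only [hz, edist_self] at h0
  refine h0.congr fun s => ?_
  rw [Lp.edist_def]
  refine eLpNorm_congr_ae ?_
  have hqmp : Measure.QuasiMeasurePreserving (fun t : ℝ => -s +ᵥ t) volume volume :=
    (measurePreserving_vadd (-s) volume).quasiMeasurePreserving
  filter_upwards [hF.coeFn_toLp, DomAddAct.vadd_Lp_ae_eq (DomAddAct.mk (-s)) (hF.toLp F),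
    hqmp.ae hF.coeFn_toLp] with t h1 h2 h3
  rw [Pi.sub_apply, h1, h2]
  simp only [Equiv.symm_apply_apply]
  rw [h3, vadd_eq_add, neg_add_eq_sub]

variable {p q : ℝ≥0∞}  {T : ℝ} {η : ℝ → ℝ} {f : ℝ → X} {G : ℝ → Y}

lemma lintegral_enorm_mul_le [hpq : p.HolderConjugate q] {f : ℝ → X} {μ : Measure ℝ}
    (hf : AEStronglyMeasurable f μ) (hG : AEStronglyMeasurable G μ) :
    ∫⁻ t, ‖f t‖ₑ * ‖G t‖ₑ ∂μ ≤ eLpNorm f p μ * eLpNorm G q μ := by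
  have := eLpNorm_le_eLpNorm_mul_eLpNorm'_of_norm (p := p) (q := q) (r := 1) hf hG
    (fun x y => ‖x‖ * ‖y‖) 1 (Eventually.of_forall fun t => by simp)
  rw [eLpNorm_one_eq_lintegral_enorm] at this
  simpa [enorm_mul] using this

variable [NormedSpace ℝ X] [CompleteSpace X]

lemma smul_sub_conv_eq (hη : IntegrableOn η (Ioo 0 T)) (r : ℝ) {t : ℝ}
    (ht : t ∈ Ioo 0 T) (h : ConvExists η f t) :
    (r * ∫ s in Ioo 0 T, η s) • f t - conv η f t
      = ∫ s in Ioo 0 T, η s • (r • f t - (Ioo 0 T).indicator f (t - s)) := by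
  rw [convExists_iff ht] at h
  have h' : Integrable (fun s => (Ioo 0 T).indicator (fun s => η s • (Ioo 0 T).indicator f (t - s)) s) := by
    refine h.congr (Eventually.of_forall fun s => ?_)
    by_cases hs : s ∈ Ioo 0 T <;> simp [hs]
  rw [integrable_indicator_iff measurableSet_Ioo] at h'
  simp only [smul_sub]
  rw [integral_sub (hη.smul_const _) h', integral_smul_const, mul_comm, mul_smul]
  congr 1
  rw [conv_eq_convolution ht, convolution_def, ← integral_indicator measurableSet_Ioo]
  refine integral_congr_ae (Eventually.of_forall fun s => ?_)
  by_cases hs : s ∈ Ioo 0 T <;> simp [hs]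

/-- Tonelli, done once for two uses: `r = 0` gives Young's inequality, and `r = 1` with `∫ η = 1`
gives the approximate-identity estimate. -/
lemma lintegral_smul_sub_conv_le (hη : IntegrableOn η (Ioo 0 T)) (hf : IntegrableOn f (Ioo 0 T))
    (hG : AEStronglyMeasurable G (volume.restrict (Ioo 0 T))) (r : ℝ) :
    ∫⁻ t in Ioo 0 T, ‖(r * ∫ s in Ioo 0 T, η s) • f t - conv η f t‖ₑ * ‖G t‖ₑ
      ≤ ∫⁻ s in Ioo 0 T, ‖η s‖ₑ *
        ∫⁻ t in Ioo 0 T, ‖r • f t - (Ioo 0 T).indicator f (t - s)‖ₑ * ‖G t‖ₑ := by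
  set μ := volume.restrict (Ioo 0 T)
  have hfi : AEStronglyMeasurable ((Ioo 0 T).indicator f) volume :=
    (hf.integrable_indicator measurableSet_Ioo).1
  have hmeas : AEStronglyMeasurable (fun z : ℝ × ℝ => (Ioo 0 T).indicator f (z.1 - z.2)) (μ.prod μ) := by
    refine (hfi.comp_quasiMeasurePreserving
      (quasiMeasurePreserving_sub_of_right_invariant volume volume)).mono_ac ?_
    rw [Measure.prod_restrict]
    exact Measure.absolutelyContinuous_of_le Measure.restrict_le_self
  have hΦ : AEMeasurable (fun z : ℝ × ℝ => ‖η z.2‖ₑ * (‖r • f z.1 -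
      (Ioo 0 T).indicator f (z.1 - z.2)‖ₑ * ‖G z.1‖ₑ)) (μ.prod μ) := by
    refine hη.1.comp_snd.enorm.mul (AEMeasurable.mul ?_ hG.comp_fst.enorm)
    exact ((hf.1.comp_fst.const_smul r).sub hmeas).enorm
  calc _ ≤ ∫⁻ t in Ioo 0 T, ∫⁻ s in Ioo 0 T, ‖η s‖ₑ * (‖r • f t -
      (Ioo 0 T).indicator f (t - s)‖ₑ * ‖G t‖ₑ) := by
        refine lintegral_mono_ae ?_
        filter_upwards [ae_convExists hη hf, ae_restrict_mem measurableSet_Ioo] with t h1 ht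
        rw [smul_sub_conv_eq hη r ht h1]
        refine (mul_le_mul_left (enorm_integral_le_lintegral_enorm _) _).trans ?_
        rw [← lintegral_mul_const' _ _ (by simp)]
        simp only [enorm_smul, mul_assoc, le_refl]
    _ = ∫⁻ s in Ioo 0 T, ∫⁻ t in Ioo 0 T, ‖η s‖ₑ * (‖r • f t -
      (Ioo 0 T).indicator f (t - s)‖ₑ * ‖G t‖ₑ) := lintegral_lintegral_swap hΦ
    _ = _ := by
        refine lintegral_congr fun s => ?_
        rw [lintegral_const_mul' _ _ (by simp)]

/-- Young's inequality tested against a function in the dual Lebesgue space. -/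
lemma lintegral_conv_mul_le [hpq : p.HolderConjugate q] (hη : IntegrableOn η (Ioo 0 T))
    (hf : MemLp f p (volume.restrict (Ioo 0 T)))
    (hG : AEStronglyMeasurable G (volume.restrict (Ioo 0 T))) :
    ∫⁻ t in Ioo 0 T, ‖conv η f t‖ₑ * ‖G t‖ₑ ≤ (∫⁻ s in Ioo 0 T, ‖η s‖ₑ) *
      (eLpNorm f p (volume.restrict (Ioo 0 T)) * eLpNorm G q (volume.restrict (Ioo 0 T))) := by
  have hp1 : 1 ≤ p := ENNReal.HolderConjugate.one_le p q
  have h := lintegral_smul_sub_conv_le hη (hf.integrable hp1) hG 0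
  simp only [zero_mul, zero_smul, zero_sub, enorm_neg] at h
  refine h.trans ?_
  have hfi : MemLp ((Ioo 0 T).indicator f) p volume :=
    (memLp_indicator_iff_restrict measurableSet_Ioo).2 hf
  rw [← lintegral_mul_const'' _ hη.1.enorm]
  refine lintegral_mono fun s => ?_
  have hmp : MeasurePreserving (fun t : ℝ => t - s) volume volume :=
    measurePreserving_sub_right volume s
  refine mul_le_mul_right ((lintegral_enorm_mul_le (p := p) (q := q)
    (hfi.1.comp_measurePreserving hmp).restrict hG).trans (mul_le_mul_left ?_ _)) _
  refine (eLpNorm_mono_measure _ Measure.restrict_le_self).trans ?_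
  refine (eLpNorm_comp_measurePreserving hfi.1 hmp).le.trans ?_
  rw [eLpNorm_indicator_eq_eLpNorm_restrict measurableSet_Ioo]

/-- Convolution with probability densities concentrating at `0` is an approximate identity. -/
lemma lintegral_sub_conv_mul_le [hpq : p.HolderConjugate q] (hp : p ≠ ⊤)
    (hf : MemLp f p (volume.restrict (Ioo 0 T)))
    (hG : MemLp G q (volume.restrict (Ioo 0 T))) {r : ℝ≥0∞} (hr : 0 < r) :
    ∃ ε₀ > 0, ∀ η : ℝ → ℝ, IntegrableOn η (Ioo 0 T) → (∀ s ∈ Ioo 0 T, 0 ≤ η s) →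
      (∀ s ∈ Ioo 0 T, ε₀ ≤ s → η s = 0) → ∫ s in Ioo 0 T, η s = 1 →
      ∫⁻ t in Ioo 0 T, ‖f t - conv η f t‖ₑ * ‖G t‖ₑ ≤ r := by
  have hp1 : 1 ≤ p := ENNReal.HolderConjugate.one_le p q
  have hfi : MemLp ((Ioo 0 T).indicator f) p volume :=
    (memLp_indicator_iff_restrict measurableSet_Ioo).2 hf
  have h1 : Tendsto (fun s : ℝ => eLpNorm (fun t => (Ioo 0 T).indicator f t -
      (Ioo 0 T).indicator f (t - s)) p volume * eLpNorm G q (volume.restrict (Ioo 0 T)))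
      (𝓝 0) (𝓝 (0 * eLpNorm G q (volume.restrict (Ioo 0 T)))) :=
    ENNReal.Tendsto.mul_const (tendsto_eLpNorm_sub_translate hp1 hp hfi) (Or.inr hG.2.ne)
  rw [zero_mul] at h1
  obtain ⟨ε₀, hε₀, h2⟩ := Metric.eventually_nhds_iff.1 (h1.eventually_lt_const hr)
  refine ⟨ε₀, hε₀, fun η hη hη0 hηs hη1 => ?_⟩
  have h := lintegral_smul_sub_conv_le hη (hf.integrable hp1) hG.1 1
  simp only [hη1, mul_one, one_smul] at h
  refine h.trans ?_
  have h3 : ∫⁻ s in Ioo 0 T, ‖η s‖ₑ = 1 := by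
    have h4 := ofReal_integral_eq_lintegral_ofReal hη
      ((ae_restrict_mem measurableSet_Ioo).mono fun s hs => hη0 s hs)
    rw [hη1, ENNReal.ofReal_one] at h4
    rw [h4]
    refine setLIntegral_congr_fun measurableSet_Ioo fun s hs => ?_
    exact Real.enorm_of_nonneg (hη0 s hs)
  calc _ ≤ ∫⁻ s in Ioo 0 T, ‖η s‖ₑ * r := by
        refine setLIntegral_mono' measurableSet_Ioo fun s hs => ?_
        by_cases hs' : ε₀ ≤ s
        · simp [hηs s hs hs']
        refine mul_le_mul_right (le_trans ?_ (h2 (y := s) ?_).le) _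
        · have hmp : MeasurePreserving (fun t : ℝ => t - s) volume volume :=
            measurePreserving_sub_right volume s
          have hm : AEStronglyMeasurable (fun t => (Ioo 0 T).indicator f t -
              (Ioo 0 T).indicator f (t - s)) volume :=
            hfi.1.sub (hfi.1.comp_measurePreserving hmp)
          refine le_trans ?_ ((lintegral_enorm_mul_le (p := p) (q := q) hm.restrict hG.1).trans
            (mul_le_mul_left (eLpNorm_mono_measure _ Measure.restrict_le_self) _))
          refine (setLIntegral_congr_fun measurableSet_Ioo fun t ht => ?_).le
          simp only [indicator_of_mem ht]
        · rw [Real.dist_eq, sub_zero, abs_of_pos hs.1]; linarith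
    _ = r := by rw [lintegral_mul_const'' _ hη.1.enorm, h3, one_mul]

end ApproximateIdentity

/-! ### Weak derivatives and primitives. -/

section WeakDerivative

open Filter Topology

/-- A smooth monotone step from `0` to `1` on `[a, a + 1 / n]`. -/
def smoothStep (a : ℝ) (n : ℕ) (t : ℝ) : ℝ := Real.smoothTransition (n * (t - a))

lemma contDiff_smoothStep (a : ℝ) (n : ℕ) : ContDiff ℝ ∞ (smoothStep a n) :=
  Real.smoothTransition.contDiff.comp (contDiff_const.mul (contDiff_id.sub contDiff_const))

lemma smoothStep_of_le {a t : ℝ} {n : ℕ} (h : t ≤ a) : smoothStep a n t = 0 :=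
  Real.smoothTransition.zero_of_nonpos (mul_nonpos_of_nonneg_of_nonpos n.cast_nonneg (by linarith))

lemma smoothStep_of_ge {a t : ℝ} {n : ℕ} (hn : 0 < n) (h : a + 1 / n ≤ t) :
    smoothStep a n t = 1 := by
  refine Real.smoothTransition.one_of_one_le ?_
  have hn' : (0 : ℝ) < n := Nat.cast_pos.2 hn
  rw [← div_le_iff₀' hn']
  linarith

lemma monotone_smoothStep (a : ℝ) (n : ℕ) : Monotone (smoothStep a n) := fun s t h =>
  Real.smoothTransition.monotone (mul_le_mul_of_nonneg_left (by linarith) n.cast_nonneg)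

lemma abs_smoothStep_le (a : ℝ) (n : ℕ) (t : ℝ) : |smoothStep a n t| ≤ 1 := by
  rw [smoothStep, abs_of_nonneg (Real.smoothTransition.nonneg _)]
  exact Real.smoothTransition.le_one _

lemma continuous_deriv_smoothStep (a : ℝ) (n : ℕ) : Continuous (deriv (smoothStep a n)) :=
  (contDiff_smoothStep a n).continuous_deriv (by simp)

lemma differentiable_smoothStep (a : ℝ) (n : ℕ) : Differentiable ℝ (smoothStep a n) :=
  (contDiff_smoothStep a n).differentiable (by simp)

lemma deriv_smoothStep_eq_zero {a t : ℝ} {n : ℕ} (hn : 0 < n) (h : t < a ∨ a + 1 / n < t) :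
    deriv (smoothStep a n) t = 0 := by
  rcases h with h | h
  · have : smoothStep a n =ᶠ[𝓝 t] fun _ => 0 := by
      filter_upwards [Iio_mem_nhds h] with s hs using smoothStep_of_le (le_of_lt hs)
    rw [this.deriv_eq, deriv_const]
  · have : smoothStep a n =ᶠ[𝓝 t] fun _ => 1 := by
      filter_upwards [Ioi_mem_nhds h] with s hs using smoothStep_of_ge hn (le_of_lt hs)
    rw [this.deriv_eq, deriv_const]

lemma eventually_add_one_div_lt {a b : ℝ} (h : a < b) : ∀ᶠ n : ℕ in atTop, a + 1 / (n : ℝ) < b := by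
  have h1 : Tendsto (fun n : ℕ => a + 1 / (n : ℝ)) atTop (𝓝 (a + 0)) :=
    tendsto_const_nhds.add tendsto_one_div_atTop_nhds_zero_nat
  rw [add_zero] at h1
  exact h1.eventually_lt_const h

lemma tendsto_smoothStep (a t : ℝ) :
    Tendsto (fun n => smoothStep a n t) atTop (𝓝 ((Ioi a).indicator 1 t)) := by
  by_cases h : a < t
  · rw [indicator_of_mem (mem_Ioi.2 h)]
    refine tendsto_const_nhds.congr' ?_
    filter_upwards [eventually_add_one_div_lt h, eventually_gt_atTop 0] with n hn hn0
      using (smoothStep_of_ge hn0 hn.le).symm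
  · rw [indicator_of_notMem (by simpa using h)]
    exact tendsto_const_nhds.congr fun n => (smoothStep_of_le (not_lt.1 h)).symm

variable {X : Type*} [NormedAddCommGroup X] [NormedSpace ℝ X]

/-- The derivatives of the steps are nonnegative, eventually of mass one, and concentrate at `a`. -/
lemma tendsto_integral_deriv_smoothStep_smul [CompleteSpace X] {T a : ℝ} (ha : a ∈ Ioo 0 T) {W : ℝ → X}
    (hW : ContinuousOn W (Icc 0 T)) :
    Tendsto (fun n => ∫ t in Ioo 0 T, deriv (smoothStep a n) t • W t) atTop (𝓝 (W a)) := by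
  have hT : 0 ≤ T := (ha.1.trans ha.2).le
  refine tendsto_setIntegral_peak_smul_of_integrableOn_of_tendsto (x₀ := a) measurableSet_Ioo
    measurableSet_Ioo subset_rfl self_mem_nhdsWithin (by simp) ?_ ?_ ?_ ?_ ?_ ?_
  · exact Eventually.of_forall fun n t _ => (monotone_smoothStep a n).deriv_nonneg
  · intro U hU haU
    obtain ⟨ε, hε, hεU⟩ := Metric.isOpen_iff.1 hU a haU
    rw [Metric.tendstoUniformlyOn_iff]
    intro r hr
    filter_upwards [eventually_add_one_div_lt (show a < a + ε by linarith),
      eventually_gt_atTop 0] with n hn hn0 t ht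
    rw [deriv_smoothStep_eq_zero hn0]
    · simpa using hr
    · by_contra! h
      refine ht.2 (hεU ?_)
      rw [Metric.mem_ball, Real.dist_eq, abs_of_nonneg (by linarith [h.1])]
      linarith [h.2]
  · refine tendsto_const_nhds.congr' ?_
    filter_upwards [eventually_add_one_div_lt ha.2, eventually_gt_atTop 0] with n hn hn0
    rw [← integral_Ioc_eq_integral_Ioo, ← intervalIntegral.integral_of_le hT,
      intervalIntegral.integral_deriv_eq_sub (fun t _ => differentiable_smoothStep a n t)
      ((continuous_deriv_smoothStep a n).intervalIntegrable _ _),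
      smoothStep_of_ge hn0 hn.le, smoothStep_of_le ha.1.le, sub_zero]
  · exact Eventually.of_forall fun n => (continuous_deriv_smoothStep a n).aestronglyMeasurable
  · exact hW.integrableOn_Icc.mono_set Ioo_subset_Icc_self
  · exact ((hW.mono Ioo_subset_Icc_self) a ha)

/-- The fundamental theorem of calculus for weak derivatives. -/
lemma IsWeakDeriv.sub_eq_integral [CompleteSpace X] {T : ℝ} {W v : ℝ → X} (h : IsWeakDeriv T W v)
    (hW : ContinuousOn W (Icc 0 T)) (hv : IntegrableOn v (Ioo 0 T)) {a b : ℝ} (ha : 0 < a)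
    (hab : a ≤ b) (hb : b < T) : W b - W a = ∫ t in a..b, v t := by
  have haT : a ∈ Ioo 0 T := ⟨ha, by linarith⟩
  have hbT : b ∈ Ioo 0 T := ⟨by linarith, hb⟩
  -- A smooth plateau tending to the indicator of `(a,b]`; `ζ n'` tested on `W` tends to `W a - W
  -- b`.
  let ζ : ℕ → ℝ → ℝ := fun n t => smoothStep a n t - smoothStep b n t
  have hint : ∀ c n, IntegrableOn (fun t => deriv (smoothStep c n) t • W t) (Ioo 0 T) := fun c n =>
    (((continuous_deriv_smoothStep c n).continuousOn.smul hW).integrableOn_Icc).mono_set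
      Ioo_subset_Icc_self
  have h1 : Tendsto (fun n => ∫ t in Ioo 0 T, deriv (ζ n) t • W t) atTop (𝓝 (W a - W b)) := by
    refine ((tendsto_integral_deriv_smoothStep_smul haT hW).sub
      (tendsto_integral_deriv_smoothStep_smul hbT hW)).congr fun n => ?_
    rw [← integral_sub (hint a n) (hint b n)]
    refine integral_congr_ae (Eventually.of_forall fun t => ?_)
    simp only [ζ]
    rw [← sub_smul, deriv_fun_sub (differentiable_smoothStep a n t) (differentiable_smoothStep b n t)]
  have h2 : Tendsto (fun n => ∫ t in Ioo 0 T, ζ n t • v t) atTop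
      (𝓝 (∫ t in Ioo 0 T, (Ioc a b).indicator v t)) := by
    refine tendsto_integral_of_dominated_convergence (fun t => 2 * ‖v t‖) (fun n => ?_)
      (hv.norm.const_mul 2) (fun n => Eventually.of_forall fun t => ?_)
      (Eventually.of_forall fun t => ?_)
    · exact ((contDiff_smoothStep a n).continuous.sub
        (contDiff_smoothStep b n).continuous).aestronglyMeasurable.smul hv.1
    · rw [norm_smul]
      refine mul_le_mul_of_nonneg_right ?_ (norm_nonneg _)
      exact (abs_sub _ _).trans (by linarith [abs_smoothStep_le a n t, abs_smoothStep_le b n t])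
    · have h3 := ((tendsto_smoothStep a t).sub (tendsto_smoothStep b t)).smul_const (v t)
      convert! h3 using 2
      simp only [indicator_apply, mem_Ioi, mem_Ioc, Pi.one_apply]
      by_cases h4 : b < t
      · simp [hab.trans_lt h4, not_le.2 h4, h4]
      · by_cases h5 : a < t <;> simp [h4, h5, not_lt.1 h4]
  have h3 : ∀ᶠ n in atTop, ∫ t in Ioo 0 T, deriv (ζ n) t • W t = -∫ t in Ioo 0 T, ζ n t • v t := by
    filter_upwards [eventually_add_one_div_lt hb, eventually_gt_atTop 0] with n hn hn0
    have hsupp : tsupport (ζ n) ⊆ Icc a (b + 1 / n) := by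
      refine closure_minimal (fun t ht => ?_) isClosed_Icc
      by_contra h4
      refine ht ?_
      simp only [mem_Icc, not_and_or, not_le] at h4
      simp only [ζ]
      rcases h4 with h4 | h4
      · rw [smoothStep_of_le h4.le, smoothStep_of_le (h4.le.trans hab), sub_zero]
      · rw [smoothStep_of_ge hn0 h4.le, smoothStep_of_ge hn0 (by linarith), sub_self]
    exact h (ζ n) ((contDiff_smoothStep a n).sub (contDiff_smoothStep b n))
      (isCompact_Icc.of_isClosed_subset (isClosed_tsupport _) hsupp)
      (hsupp.trans fun t ht => ⟨ha.trans_le ht.1, ht.2.trans_lt hn⟩)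
  have h4 := tendsto_nhds_unique (h1.congr' h3) h2.neg
  rw [← neg_sub, h4, neg_neg, integral_indicator measurableSet_Ioc,
    Measure.restrict_restrict measurableSet_Ioc, intervalIntegral.integral_of_le hab,
    inter_eq_left.2 (show Ioc a b ⊆ Ioo 0 T from fun t ht => ⟨ha.trans ht.1, ht.2.trans_lt hb⟩)]

lemma IsWeakDeriv.congr {T : ℝ} {w W v : ℝ → X} (h : IsWeakDeriv T w v)
    (hw : W =ᵐ[volume.restrict (Ioo 0 T)] w) : IsWeakDeriv T W v := fun ζ h1 h2 h3 => by
  rw [← h ζ h1 h2 h3]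
  refine integral_congr_ae ?_
  filter_upwards [hw] with t ht
  rw [ht]

lemma continuousOn_primitive_of_integrableOn {T : ℝ} {v : ℝ → X} (hv : IntegrableOn v (Ioo 0 T)) :
    ContinuousOn (fun t => ∫ s in (0 : ℝ)..t, v s) (Icc 0 T) := by
  rcases lt_or_ge T 0 with hT | hT
  · simp [Icc_eq_empty (not_le.2 hT)]
  · have h := intervalIntegral.continuousOn_primitive_interval'
      ((intervalIntegrable_iff_integrableOn_Ioo_of_le hT).2 hv) left_mem_uIcc
    rwa [uIcc_of_le hT] at h

lemma ae_eq_conv_one_of_weakDeriv [CompleteSpace X] {T : ℝ} {w v : ℝ → X} (h : IsWeakDeriv T w v)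
    (h0 : VanishesAtZero T w) (hv : IntegrableOn v (Ioo 0 T)) :
    w =ᵐ[volume.restrict (Ioo 0 T)] conv (fun _ => 1) v := by
  obtain ⟨W, hW, hWw, hW0⟩ := h0
  filter_upwards [hWw, ae_restrict_mem measurableSet_Ioo] with b hb hbT
  rw [← hb, conv_one_left]
  have hT : 0 ≤ T := (hbT.1.trans hbT.2).le
  have hv' : IntervalIntegrable v volume 0 T :=
    (intervalIntegrable_iff_integrableOn_Ioo_of_le hT).2 hv
  have hP : ContinuousOn (fun t => W t - ∫ s in (0 : ℝ)..t, v s) (Icc 0 T) :=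
    hW.sub (continuousOn_primitive_of_integrableOn hv)
  have h1 : Tendsto (fun t => W t - ∫ s in (0 : ℝ)..t, v s) (𝓝[>] 0) (𝓝 0) := by
    have := (hP 0 ⟨le_rfl, hT⟩).tendsto
    simp only [hW0, intervalIntegral.integral_same, sub_zero] at this
    refine this.mono_left ?_
    rw [nhdsWithin_le_iff]
    exact mem_of_superset (Ioc_mem_nhdsGT (hbT.1.trans hbT.2)) Ioc_subset_Icc_self
  -- `W - ∫ v` is constant on `(0,b]`, so its value at `b` is its limit at `0`, which vanishes.
  have h2 : (fun _ : ℝ => W b - ∫ s in (0 : ℝ)..b, v s) =ᶠ[𝓝[>] 0]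
      fun t => W t - ∫ s in (0 : ℝ)..t, v s := by
    filter_upwards [Ioo_mem_nhdsGT hbT.1] with a ha
    have h3 := (h.congr hWw).sub_eq_integral hW hv ha.1 ha.2.le hbT.2
    have hsub : ∀ x ∈ Ioo 0 T, ∀ y ∈ Icc 0 T, IntervalIntegrable v volume y x := fun x hx y hy =>
      hv'.mono_set (by
        rw [uIcc_of_le hT]
        exact uIcc_subset_Icc hy ⟨hx.1.le, hx.2.le⟩)
    have haT : a ∈ Ioo 0 T := ⟨ha.1, ha.2.trans hbT.2⟩
    have h4 := intervalIntegral.integral_add_adjacent_intervals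
      (hsub a haT 0 ⟨le_rfl, hT⟩) (hsub b hbT a ⟨haT.1.le, haT.2.le⟩)
    rw [← h4, ← h3]
    abel
  exact sub_eq_zero.1 (tendsto_nhds_unique (tendsto_const_nhds.congr' h2) h1)

/-- Primitives equal a.e. are equal everywhere by continuity; Lebesgue differentiation recovers the
functions. -/
lemma ae_eq_of_conv_one_ae_eq [CompleteSpace X] {T : ℝ} {f g : ℝ → X}
    (hf : IntegrableOn f (Ioo 0 T)) (hg : IntegrableOn g (Ioo 0 T))
    (h : conv (fun _ => 1) f =ᵐ[volume.restrict (Ioo 0 T)] conv (fun _ => 1) g) :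
    f =ᵐ[volume.restrict (Ioo 0 T)] g := by
  rcases le_or_gt T 0 with hT | hT
  · simp [Ioo_eq_empty (not_lt.2 hT), EventuallyEq]
  have hf' := (intervalIntegrable_iff_integrableOn_Ioo_of_le hT.le).2 hf
  have hg' := (intervalIntegrable_iff_integrableOn_Ioo_of_le hT.le).2 hg
  have heq : EqOn (fun t => ∫ s in (0 : ℝ)..t, f s) (fun t => ∫ s in (0 : ℝ)..t, g s) (Ioo 0 T) := by
    refine Measure.eqOn_open_of_ae_eq (μ := volume) ?_ isOpen_Ioo
      ((continuousOn_primitive_of_integrableOn hf).mono Ioo_subset_Icc_self)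
      ((continuousOn_primitive_of_integrableOn hg).mono Ioo_subset_Icc_self)
    exact h.mono fun t ht => by simpa only [conv_one_left] using ht
  filter_upwards [ae_restrict_of_ae hf'.ae_hasDerivAt_integral,
    ae_restrict_of_ae hg'.ae_hasDerivAt_integral, ae_restrict_mem measurableSet_Ioo]
    with t h1 h2 ht
  rw [uIcc_of_le hT.le] at h1 h2
  have h3 := h1 ⟨ht.1.le, ht.2.le⟩ 0 ⟨le_rfl, hT.le⟩
  have h4 := h2 ⟨ht.1.le, ht.2.le⟩ 0 ⟨le_rfl, hT.le⟩
  refine h3.unique (h4.congr_of_eventuallyEq ?_)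
  filter_upwards [isOpen_Ioo.mem_nhds ht] with s hs using heq hs

end WeakDerivative

/-! ### Conjugate kernels and the averaging density. -/

section Kernels

open Filter Topology

variable {X : Type*} [NormedAddCommGroup X]

lemma IsKernel.integrableOn {k : ℝ → ℝ} (hk : IsKernel k) (T : ℝ) : IntegrableOn k (Ioo 0 T) :=
  (hk.locallyIntegrable.integrableOn_compact_subset Icc_subset_Ici_self isCompact_Icc).mono_set
    Ioo_subset_Icc_self

/-- A divergent integral has the default value `0`, which is not `1`. -/
lemma IsConjugateKernel.convExists {k ℓ : ℝ → ℝ} (h : IsConjugateKernel k ℓ) {t : ℝ} (ht : 0 < t) :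
    ConvExists k ℓ t := by
  by_contra h1
  have h2 := h.conv_eq_one t ht
  rw [conv, intervalIntegral.integral_undef h1] at h2
  exact zero_ne_one h2

/-- Translation to the right by `δ`, extended by `0`. -/
def shift (δ : ℝ) (f : ℝ → X) (t : ℝ) : X := if δ < t then f (t - δ) else 0

lemma integrableOn_shift {δ T : ℝ} (hδ : 0 ≤ δ) {f : ℝ → X} (hf : IntegrableOn f (Ioo 0 T)) :
    IntegrableOn (shift δ f) (Ioo 0 T) := by
  have h := ((hf.integrable_indicator measurableSet_Ioo).comp_sub_right δ).integrableOn
    (s := Ioo 0 T)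
  refine h.congr_fun (fun t ht => ?_) measurableSet_Ioo
  simp only [shift, indicator_apply, mem_Ioo, sub_pos]
  refine if_congr ⟨fun h => h.1, fun h => ⟨h, by linarith [ht.2]⟩⟩ rfl rfl

variable [NormedSpace ℝ X]

lemma conv_shift {δ : ℝ} (hδ : 0 ≤ δ) (a : ℝ → ℝ) (f : ℝ → X) {t : ℝ} (ht : 0 ≤ t) :
    conv (shift δ a) f t = shift δ (conv a f) t := by
  rw [conv_eq_setIntegral ht, shift]
  split_ifs with h
  · rw [conv_eq_setIntegral (by linarith)]
    rw [setIntegral_eq_of_subset_of_forall_sdiff_eq_zero (s := Ioo 0 (t - δ)) measurableSet_Ioo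
      (Ioo_subset_Ioo_right (by linarith)) (f := fun s => shift δ a (t - s) • f s)]
    · refine setIntegral_congr_fun measurableSet_Ioo fun s hs => ?_
      have : δ < t - s := by linarith [hs.2]
      simp only [shift, if_pos this]
      congr 2; ring
    · intro s hs
      have : ¬ δ < t - s := fun h' => hs.2 ⟨hs.1.1, by linarith⟩
      simp [shift, this]
  · refine setIntegral_eq_zero_of_forall_eq_zero fun s hs => ?_
    have : ¬ δ < t - s := fun h' => h (by linarith [hs.1])
    simp [shift, this]

/-- The uniform probability density on `(0, δ]`. -/
def box (δ : ℝ) : ℝ → ℝ := (Iic δ).indicator fun _ => δ⁻¹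

lemma box_nonneg {δ : ℝ} (hδ : 0 < δ) (t : ℝ) : 0 ≤ box δ t :=
  indicator_nonneg (fun _ _ => (inv_pos.2 hδ).le) t

lemma integrableOn_box (δ T : ℝ) : IntegrableOn (box δ) (Ioo 0 T) :=
  (integrableOn_const (by simp)).indicator measurableSet_Iic

lemma integral_box (δ t : ℝ) :
    ∫ s in Ioo 0 t, box δ s = δ⁻¹ * volume.real (Ioo 0 t ∩ Iic δ) := by
  rw [box, setIntegral_indicator measurableSet_Iic, setIntegral_const, smul_eq_mul, mul_comm]

lemma integral_box_le {δ t : ℝ} (hδ : 0 < δ) : ∫ s in Ioo 0 t, box δ s ≤ 1 := by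
  rw [integral_box]
  have h : volume.real (Ioo 0 t ∩ Iic δ) ≤ δ := by
    refine (measureReal_mono (show Ioo 0 t ∩ Iic δ ⊆ Ioc 0 δ from fun s hs => ⟨hs.1.1, hs.2⟩)
      (by simp)).trans ?_
    simp [hδ.le]
  calc _ ≤ δ⁻¹ * δ := mul_le_mul_of_nonneg_left h (inv_pos.2 hδ).le
    _ = 1 := inv_mul_cancel₀ hδ.ne'

lemma integral_box_eq {δ T : ℝ} (hδ : 0 < δ) (hT : δ < T) : ∫ s in Ioo 0 T, box δ s = 1 := by
  rw [integral_box, show Ioo 0 T ∩ Iic δ = Ioc 0 δ from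
    Set.ext fun s => ⟨fun hs => ⟨hs.1.1, hs.2⟩, fun hs => ⟨⟨hs.1, hs.2.trans_lt hT⟩, hs.2⟩⟩]
  simp [hδ.le, hδ.ne']

variable {k ℓ : ℝ → ℝ}

lemma conv_head_tail (hℓ : IsConjugateKernel k ℓ) (ε : ℝ) {t : ℝ} (ht : 0 < t) :
    ConvExists k ((Iio ε).indicator ℓ) t ∧ ConvExists k ((Ici ε).indicator ℓ) t ∧
      conv k ((Ici ε).indicator ℓ) t = 1 - conv k ((Iio ε).indicator ℓ) t := by
  have h := hℓ.convExists ht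
  have key : ∀ A : Set ℝ, MeasurableSet A → ConvExists k (A.indicator ℓ) t := fun A hA => by
    rw [convExists_iff_integrableOn ht.le] at h ⊢
    refine (Integrable.indicator h hA).congr (Eventually.of_forall fun s => ?_)
    by_cases hs : s ∈ A <;> simp [hs]
  refine ⟨key _ measurableSet_Iio, key _ measurableSet_Ici, ?_⟩
  rw [← hℓ.conv_eq_one t ht, ← h.conv_sub_right (key _ measurableSet_Iio)]
  congr 1
  ext s
  by_cases hs : s < ε
  · simp [hs, not_le.2 hs]
  · simp [not_lt.1 hs, hs]

lemma conv_tail_of_le {ε t : ℝ} (ht : 0 ≤ t) (h : t ≤ ε) : conv k ((Ici ε).indicator ℓ) t = 0 := by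
  rw [conv_eq_setIntegral ht]
  refine setIntegral_eq_zero_of_forall_eq_zero fun s hs => ?_
  rw [indicator_of_notMem (by simpa using hs.2.trans_le h), smul_zero]

lemma conv_tail_nonneg (hk : IsKernel k) (hℓ : IsKernel ℓ) (ε : ℝ) {t : ℝ} (ht : 0 ≤ t) :
    0 ≤ conv k ((Ici ε).indicator ℓ) t := by
  rw [conv_eq_setIntegral ht]
  refine setIntegral_nonneg measurableSet_Ioo fun s hs => ?_
  exact mul_nonneg (hk.nonneg _ (by linarith [hs.2]))
    (indicator_apply_nonneg (fun _ => hℓ.nonneg _ hs.1))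

lemma conv_head_nonneg (hk : IsKernel k) (hℓ : IsKernel ℓ) (ε : ℝ) {t : ℝ} (ht : 0 ≤ t) :
    0 ≤ conv k ((Iio ε).indicator ℓ) t := by
  rw [conv_eq_setIntegral ht]
  refine setIntegral_nonneg measurableSet_Ioo fun s hs => ?_
  exact mul_nonneg (hk.nonneg _ (by linarith [hs.2]))
    (indicator_apply_nonneg (fun _ => hℓ.nonneg _ hs.1))

/-- `k * (ℓ 1_{[ε,∞)})` is nondecreasing: it is the distribution function of the measure `h` with
`h * ℓ = ℓ 1_{[ε,∞)}`. -/
lemma monotoneOn_conv_tail (hk : IsKernel k) (hℓ : IsConjugateKernel k ℓ) (ε : ℝ) :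
    MonotoneOn (conv k ((Ici ε).indicator ℓ)) (Ioi 0) := by
  intro s hs t ht hst
  simp only [mem_Ioi] at hs ht
  rcases le_or_gt s ε with h | h
  · rw [conv_tail_of_le hs.le h]
    exact conv_tail_nonneg hk hℓ.isKernel ε ht.le
  obtain ⟨hs1, -, hs2⟩ := conv_head_tail hℓ ε hs
  obtain ⟨ht1, -, ht2⟩ := conv_head_tail hℓ ε ht
  rw [hs2, ht2]
  -- The complement `k * (ℓ 1_{(-∞,ε)})` decreases past `ε`: the head lives in `(0,ε) ⊂ (0,s)`, so
  -- only `k (t - r) ≤ k (s - r)` matters.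
  refine sub_le_sub_left ?_ _
  rw [convExists_iff_integrableOn hs.le] at hs1
  rw [convExists_iff_integrableOn ht.le] at ht1
  have hsub : Ioo 0 s ⊆ Ioo 0 t := Ioo_subset_Ioo_right hst
  rw [conv_eq_setIntegral hs.le, conv_eq_setIntegral ht.le,
    setIntegral_eq_of_subset_of_forall_sdiff_eq_zero measurableSet_Ioo hsub
      (f := fun r => k (t - r) • (Iio ε).indicator ℓ r)]
  · refine setIntegral_mono_on (ht1.mono_set hsub) hs1 measurableSet_Ioo fun r hr => ?_
    refine mul_le_mul_of_nonneg_right ?_ (indicator_apply_nonneg (fun _ => hℓ.isKernel.nonneg _ hr.1))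
    exact hk.antitone (by simpa using hr.2) (by simpa using hr.2.trans_le hst) (by linarith)
  · intro r hr
    rw [indicator_of_notMem, smul_zero]
    intro h'
    exact hr.2 ⟨hr.1.1, lt_trans h' h⟩

lemma conv_left_comm [CompleteSpace X] {T : ℝ} {a b : ℝ → ℝ} {f : ℝ → X}
    (ha : IntegrableOn a (Ioo 0 T)) (hb : IntegrableOn b (Ioo 0 T)) (hf : IntegrableOn f (Ioo 0 T)) :
    conv a (conv b f) =ᵐ[volume.restrict (Ioo 0 T)] conv b (conv a f) := by
  refine (conv_assoc ha hb hf).symm.trans ?_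
  rw [conv_comm a b]
  exact conv_assoc hb ha hf

/-- A nonnegative subprobability density `h` with `ℓ * h = ρ_δ * (ℓ 1_{[ε,∞)})`. -/
lemma exists_subprobability (hk : IsKernel k) (hℓ : IsConjugateKernel k ℓ) {ε δ : ℝ}
    (hδ : 0 < δ) (T : ℝ) :
    ∃ h : ℝ → ℝ, IntegrableOn h (Ioo 0 T) ∧
      (∀ᵐ t ∂(volume.restrict (Ioo 0 T)), 0 ≤ h t) ∧
      conv ℓ h =ᵐ[volume.restrict (Ioo 0 T)] conv (box δ) ((Ici ε).indicator ℓ) ∧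
      ∀ᵐ t ∂(volume.restrict (Ioo 0 T)), conv (fun _ => 1) h t ≤ 1 := by
  set q := (Ici ε).indicator ℓ
  have hkT := hk.integrableOn T
  have hℓT := hℓ.isKernel.integrableOn T
  have hqT : IntegrableOn q (Ioo 0 T) := Integrable.indicator hℓT measurableSet_Ici
  have hsT := integrableOn_shift hδ.le hkT
  have hbT := integrableOn_box δ T
  -- The backward difference quotient of `k`. Then `kδ * q` is that of the nondecreasing `k * q`,
  -- and `ℓ * kδ` is that of `1_{t > 0}`, namely `box δ`.
  let kδ : ℝ → ℝ := fun s => δ⁻¹ * (k s - shift δ k s)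
  have hkδT : IntegrableOn kδ (Ioo 0 T) := (hkT.sub hsT).const_mul _
  have hH1 : ∀ t, 0 < t → conv k q t ≤ 1 := fun t ht => by
    rw [(conv_head_tail hℓ ε ht).2.2]
    linarith [conv_head_nonneg hk hℓ.isKernel ε ht.le]
  have hmem := ae_restrict_mem (μ := (volume : Measure ℝ)) (measurableSet_Ioo (a := (0 : ℝ)) (b := T))
  have hexp : ∀ f : ℝ → ℝ, ∀ t, 0 < t → ConvExists k f t → ConvExists (shift δ k) f t →
      conv kδ f t = δ⁻¹ * (conv k f t - shift δ (conv k f) t) := fun f t ht h1 h2 => by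
    rw [conv_const_mul_left, h1.conv_sub_left h2, conv_shift hδ.le k f ht.le, smul_eq_mul]
  have hh0 : ∀ᵐ t ∂(volume.restrict (Ioo 0 T)), 0 ≤ conv kδ q t := by
    filter_upwards [ae_convExists hkT hqT, ae_convExists hsT hqT, hmem] with t h1 h2 ht
    rw [hexp q t ht.1 h1 h2]
    refine mul_nonneg (inv_pos.2 hδ).le (sub_nonneg.2 ?_)
    rw [shift]
    split_ifs with h
    · exact monotoneOn_conv_tail hk hℓ ε (by simpa using h) ht.1 (by linarith)
    · exact conv_tail_nonneg hk hℓ.isKernel ε ht.1.le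
  have hℓkδ : conv ℓ kδ =ᵐ[volume.restrict (Ioo 0 T)] box δ := by
    rw [conv_comm]
    filter_upwards [ae_convExists hkT hℓT, ae_convExists hsT hℓT, hmem] with t h1 h2 ht
    rw [hexp ℓ t ht.1 h1 h2, hℓ.conv_eq_one t ht.1, shift, box, indicator_apply]
    by_cases h : δ < t
    · rw [if_pos h, hℓ.conv_eq_one _ (by linarith), if_neg (by simpa using h), sub_self, mul_zero]
    · rw [if_neg h, if_pos (by simpa using h), sub_zero, mul_one]
  have hℓh : conv ℓ (conv kδ q) =ᵐ[volume.restrict (Ioo 0 T)] conv (box δ) q :=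
    (conv_assoc hℓT hkδT hqT).symm.trans (conv_ae_congr hℓkδ (ae_eq_refl q))
  have hhT := integrableOn_conv hkδT hqT
  refine ⟨conv kδ q, hhT, hh0, hℓh, ?_⟩
  -- `1 * h = k * ℓ * h = k * ρ_δ * q = ρ_δ * (k * q)`, and `k * q ≤ 1`.
  have h1 : conv (fun _ => 1) (conv kδ q) =ᵐ[volume.restrict (Ioo 0 T)]
      conv (box δ) (conv k q) := by
    have h2 : (fun _ => 1 : ℝ → ℝ) =ᵐ[volume.restrict (Ioo 0 T)] conv k ℓ := by
      filter_upwards [hmem] with t ht using (hℓ.conv_eq_one t ht.1).symm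
    exact (conv_ae_congr h2 (ae_eq_refl _)).trans <| (conv_assoc hkT hℓT hhT).trans <|
      (conv_ae_congr (ae_eq_refl k) hℓh).trans (conv_left_comm hkT hbT hqT)
  have h3 := conv_mono hbT (integrableOn_conv hkT hqT)
    (integrableOn_const (C := (1 : ℝ)) (by simp)) (Eventually.of_forall fun s => box_nonneg hδ s)
    (hmem.mono fun t ht => hH1 t ht.1)
  filter_upwards [h1, h3, hmem] with t ht1 ht2 ht
  rw [ht1]
  refine ht2.trans ?_
  rw [conv_comm, conv_one_left, intervalIntegral.integral_of_le ht.1.le,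
    integral_Ioc_eq_integral_Ioo]
  exact integral_box_le hδ

/-- Otherwise `ℓ` vanishes a.e. on `(0,ε)`, contradicting `(k * ℓ)(ε) = 1`. This permits normalising
the head. -/
lemma integral_head_pos (hℓ : IsConjugateKernel k ℓ) {ε T : ℝ} (hε : 0 < ε) (hT : ε < T) :
    0 < ∫ s in Ioo 0 T, (Iio ε).indicator ℓ s := by
  have h0 : ∀ s ∈ Ioo 0 T, 0 ≤ (Iio ε).indicator ℓ s := fun s hs =>
    indicator_apply_nonneg (fun _ => hℓ.isKernel.nonneg _ hs.1)
  refine lt_of_le_of_ne (setIntegral_nonneg measurableSet_Ioo h0) fun h => ?_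
  have h1 := (setIntegral_eq_zero_iff_of_nonneg_ae
    ((ae_restrict_mem measurableSet_Ioo).mono h0)
    (Integrable.indicator (hℓ.isKernel.integrableOn T) measurableSet_Iio)).1 h.symm
  have h2 : conv k ℓ ε = 0 := by
    rw [conv_eq_setIntegral hε.le]
    refine integral_eq_zero_of_ae ?_
    filter_upwards [ae_restrict_Ioo_of_mem h1 ⟨hε, hT⟩, ae_restrict_mem measurableSet_Ioo]
      with s h3 h4
    rw [indicator_of_mem (mem_Iio.2 h4.2)] at h3
    simp [h3]
  rw [hℓ.conv_eq_one ε hε] at h2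
  exact one_ne_zero h2

end Kernels

/-! ### The averaged inequality and its limit. -/

section ChainRule

open Filter Topology
open scoped ENNReal

variable {H : Type*} [NormedAddCommGroup H] [InnerProductSpace ℝ H]
  {T : ℝ} {v w g : ℝ → H} {F h k ℓ : ℝ → ℝ}

lemma integrableOn_inner (hv : MemL2 T v) (hg : MemL2 T g) :
    IntegrableOn (fun t => inner ℝ (v t) (g t)) (Ioo 0 T) := by
  refine Integrable.mono (hv.norm.integrable_mul hg.norm) (hv.1.inner (𝕜 := ℝ) hg.1)
    (Eventually.of_forall fun t => ?_)
  simpa using norm_inner_le_norm (𝕜 := ℝ) (v t) (g t)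

lemma enorm_inner_le (x y : H) : ‖(inner ℝ x y : ℝ)‖ₑ ≤ ‖x‖ₑ * ‖y‖ₑ := by
  simp only [← ofReal_norm]
  rw [← ENNReal.ofReal_mul (norm_nonneg _)]
  exact ENNReal.ofReal_le_ofReal (norm_inner_le_norm x y)

variable [CompleteSpace H]

/-- The pointwise inequality `F - h * F ≤ (w - h * w, g)` for subprobability densities `h`. -/
lemma sub_conv_le_inner {P : ℝ → Prop} (hP : ∀ᵐ t ∂(volume.restrict (Ioo 0 T)), P t)
    (hF : ∀ t, P t → F t ≤ inner ℝ (w t) (g t))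
    (hFF : ∀ t s, P t → P s → F t - F s ≤ inner ℝ (w t - w s) (g t))
    (hFi : IntegrableOn F (Ioo 0 T)) (hwi : IntegrableOn w (Ioo 0 T))
    (hhi : IntegrableOn h (Ioo 0 T))
    (hh0 : ∀ᵐ t ∂(volume.restrict (Ioo 0 T)), 0 ≤ h t)
    (hh1 : ∀ᵐ t ∂(volume.restrict (Ioo 0 T)), conv (fun _ => 1) h t ≤ 1) :
    ∀ᵐ t ∂(volume.restrict (Ioo 0 T)),
      F t - conv h F t ≤ inner ℝ (w t - conv h w t) (g t) := by
  have h1i : IntegrableOn (fun _ : ℝ => (1 : ℝ)) (Ioo 0 T) := integrableOn_const (by simp)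
  filter_upwards [hP, hh1, ae_convExists hhi hFi, ae_convExists hhi hwi, ae_convExists hhi h1i,
    ae_restrict_mem measurableSet_Ioo] with t hPt hc hcF hcw hc1 ht
  rw [convExists_iff_integrableOn ht.1.le] at hcF hcw hc1
  rw [conv_comm, conv_eq_setIntegral ht.1.le] at hc
  rw [conv_eq_setIntegral ht.1.le, conv_eq_setIntegral ht.1.le]
  have hiw : IntegrableOn (fun s => inner ℝ (h (t - s) • w s) (g t)) (Ioo 0 t) :=
    hcw.inner_const (g t)
  have h2 : ∫ s in Ioo 0 t, (h (t - s) • (1 : ℝ)) * F t - h (t - s) • F s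
      ≤ ∫ s in Ioo 0 t, (h (t - s) • (1 : ℝ)) * inner ℝ (w t) (g t)
        - inner ℝ (h (t - s) • w s) (g t) := by
    refine integral_mono_ae ((hc1.mul_const _).sub hcF) ((hc1.mul_const _).sub hiw) ?_
    filter_upwards [ae_restrict_Ioo_sub_left hh0 ht, ae_restrict_Ioo_of_mem hP ht] with s h3 h4
    have h5 := mul_le_mul_of_nonneg_left (hFF t s hPt h4) h3
    rw [inner_sub_left] at h5
    rw [real_inner_smul_left]
    simp only [smul_eq_mul]
    linarith
  rw [integral_sub (hc1.mul_const _) hcF, integral_sub (hc1.mul_const _) hiw,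
    integral_mul_const, integral_mul_const] at h2
  have h6 : ∫ s in Ioo 0 t, inner ℝ (h (t - s) • w s) (g t)
      = inner ℝ (∫ s in Ioo 0 t, h (t - s) • w s) (g t) := by
    rw [real_inner_comm, ← integral_inner hcw]
    exact integral_congr_ae (Eventually.of_forall fun s => real_inner_comm _ _)
  rw [h6] at h2
  rw [inner_sub_left]
  -- The mass missing from `h` on `(0,t)` is placed at the origin, where `F` and `w` have the value
  -- `0`.
  have h7 := mul_le_mul_of_nonneg_left (hF t hPt) (sub_nonneg.2 hc)
  linarith

/-- Young's inequality tested against `g` suffices; `κ * v ∈ L²` is not needed. -/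
lemma integrableOn_inner_conv {κ : ℝ → ℝ} (hκ : IntegrableOn κ (Ioo 0 T)) (hv : MemL2 T v)
    (hg : MemL2 T g) : IntegrableOn (fun t => inner ℝ (conv κ v t) (g t)) (Ioo 0 T) := by
  refine ⟨(integrableOn_conv hκ (hv.integrable one_le_two)).1.inner (𝕜 := ℝ) hg.1, ?_⟩
  refine (lintegral_mono fun t => ?_).trans_lt
    ((lintegral_conv_mul_le (p := 2) (q := 2) hκ hv hg.1).trans_lt ?_)
  · exact enorm_inner_le (conv κ v t) (g t)
  · exact ENNReal.mul_lt_top hκ.2 (ENNReal.mul_lt_top hv.2 hg.2)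

/-- The comparison `ℓ * (κ * v, g) ≥ κ * F` with `κ = ℓ - ρ_δ * (ℓ 1_{[ε,∞)})`. -/
lemma conv_le_conv_inner (hk : IsKernel k) (hℓ : IsConjugateKernel k ℓ)
    {P : ℝ → Prop} (hP : ∀ᵐ t ∂(volume.restrict (Ioo 0 T)), P t)
    (hF : ∀ t, P t → F t ≤ inner ℝ (w t) (g t))
    (hFF : ∀ t s, P t → P s → F t - F s ≤ inner ℝ (w t - w s) (g t))
    (hFi : IntegrableOn F (Ioo 0 T)) (hwi : IntegrableOn w (Ioo 0 T))
    (hv : MemL2 T v) (hg : MemL2 T g)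
    (hwv : w =ᵐ[volume.restrict (Ioo 0 T)] conv ℓ v) {ε δ : ℝ} (hδ : 0 < δ) {κ : ℝ → ℝ}
    (hκ : κ = fun s => ℓ s - conv (box δ) ((Ici ε).indicator ℓ) s) :
    ∀ᵐ t ∂(volume.restrict (Ioo 0 T)),
      conv κ F t ≤ conv ℓ (fun s => inner ℝ (conv κ v s) (g s)) t := by
  obtain ⟨h, hhi, hh0, hℓh, hh1⟩ := exists_subprobability (ε := ε) hk hℓ hδ T
  have hℓi := hℓ.isKernel.integrableOn T
  have hvi : IntegrableOn v (Ioo 0 T) := hv.integrable one_le_two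
  have hκ' : κ =ᵐ[volume.restrict (Ioo 0 T)] fun s => ℓ s - conv ℓ h s := by
    filter_upwards [hℓh] with t ht
    rw [hκ, ht]
  have hℓhi := integrableOn_conv hℓi hhi
  have hκi : IntegrableOn κ (Ioo 0 T) := (hℓi.sub hℓhi).congr hκ'.symm
  have hκv : conv κ v =ᵐ[volume.restrict (Ioo 0 T)] fun t => w t - conv h w t := by
    have h1 : conv (conv ℓ h) v =ᵐ[volume.restrict (Ioo 0 T)] conv h w :=
      (conv_assoc hℓi hhi hvi).trans <| (conv_left_comm hℓi hhi hvi).trans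
        (conv_ae_congr (ae_eq_refl h) hwv.symm)
    filter_upwards [conv_ae_congr hκ' (ae_eq_refl v), conv_sub_left hℓi hℓhi hvi, h1, hwv]
      with t h2 h3 h4 h5
    rw [h2, h3, h4, h5]
  have hκF : conv κ F =ᵐ[volume.restrict (Ioo 0 T)] conv ℓ fun t => F t - conv h F t := by
    filter_upwards [conv_ae_congr hκ' (ae_eq_refl F), conv_sub_left hℓi hℓhi hFi,
      conv_assoc hℓi hhi hFi, conv_sub_right hℓi hFi (integrableOn_conv hhi hFi)] with t h2 h3 h4 h5
    rw [h2, h3, h4, h5]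
  have key : ∀ᵐ t ∂(volume.restrict (Ioo 0 T)),
      F t - conv h F t ≤ inner ℝ (conv κ v t) (g t) := by
    filter_upwards [sub_conv_le_inner hP hF hFF hFi hwi hhi hh0 hh1, hκv] with t h1 h2
    rwa [h2]
  have hmono := conv_mono hℓi (hFi.sub (integrableOn_conv hhi hFi))
    (integrableOn_inner_conv hκi hv hg)
    ((ae_restrict_mem measurableSet_Ioo).mono fun s hs => hℓ.isKernel.nonneg s hs.1) key
  filter_upwards [hκF, hmono] with t h1 h2
  rw [h1]
  exact h2

/-- `η` is the approximate identity and `θ` an error small in `L¹`. -/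
lemma lintegral_sub_conv_add_mul_le {X Y : Type*} [NormedAddCommGroup X] [NormedSpace ℝ X]
    [CompleteSpace X] [NormedAddCommGroup Y] {p q : ℝ≥0∞} [p.HolderConjugate q] {η θ : ℝ → ℝ}
    {f : ℝ → X} {G : ℝ → Y} (hη : IntegrableOn η (Ioo 0 T)) (hθ : IntegrableOn θ (Ioo 0 T))
    (hf : MemLp f p (volume.restrict (Ioo 0 T)))
    (hG : AEStronglyMeasurable G (volume.restrict (Ioo 0 T))) :
    ∫⁻ t in Ioo 0 T, ‖f t - conv (fun s => η s + θ s) f t‖ₑ * ‖G t‖ₑ ≤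
      (∫⁻ t in Ioo 0 T, ‖f t - conv η f t‖ₑ * ‖G t‖ₑ) + (∫⁻ s in Ioo 0 T, ‖θ s‖ₑ) *
      (eLpNorm f p (volume.restrict (Ioo 0 T)) * eLpNorm G q (volume.restrict (Ioo 0 T))) := by
  have hfi : IntegrableOn f (Ioo 0 T) := hf.integrable (ENNReal.HolderConjugate.one_le p q)
  calc _ ≤ ∫⁻ t in Ioo 0 T, (‖f t - conv η f t‖ₑ * ‖G t‖ₑ + ‖conv θ f t‖ₑ * ‖G t‖ₑ) := by
        refine lintegral_mono_ae ?_
        filter_upwards [ae_convExists hη hfi, ae_convExists hθ hfi] with t h1 h2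
        have h3 : conv (fun s => η s + θ s) f t = conv η f t + conv θ f t := by
          simp only [conv, add_smul]
          exact intervalIntegral.integral_add h1 h2
        rw [h3, ← sub_sub, ← add_mul]
        exact mul_le_mul_left enorm_sub_le _
    _ = (∫⁻ t in Ioo 0 T, ‖f t - conv η f t‖ₑ * ‖G t‖ₑ)
          + ∫⁻ t in Ioo 0 T, ‖conv θ f t‖ₑ * ‖G t‖ₑ :=
        lintegral_add_right' _ ((integrableOn_conv hθ hfi).1.enorm.mul hG.enorm)
    _ ≤ _ := add_le_add le_rfl (lintegral_conv_mul_le hθ hf hG)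

/-- Normalised, the kernels `ℓ - ρ_δ * (ℓ 1_{[ε,∞)})` form an approximate identity. -/
lemma exists_approximate_identity (hℓ : IsConjugateKernel k ℓ) (hT : 0 < T)
    (hF : IntegrableOn F (Ioo 0 T)) (hv : MemL2 T v) (hg : MemL2 T g) {r : ℝ≥0∞} (hr : 0 < r) :
    ∃ ε δ c : ℝ, 0 < δ ∧ 0 < c ∧ ∀ κ : ℝ → ℝ,
      (κ = fun s => ℓ s - conv (box δ) ((Ici ε).indicator ℓ) s) →
      ∫⁻ t in Ioo 0 T, ‖v t - c • conv κ v t‖ₑ * ‖g t‖ₑ ≤ r ∧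
      ∫⁻ t in Ioo 0 T, ‖F t - c * conv κ F t‖ₑ ≤ r := by
  have hr2 : 0 < r / 2 := ENNReal.half_pos hr.ne'
  have hF' : MemLp F 1 (volume.restrict (Ioo 0 T)) := memLp_one_iff_integrable.2 hF
  have h1 : MemLp (fun _ : ℝ => (1 : ℝ)) ⊤ (volume.restrict (Ioo 0 T)) := memLp_top_const 1
  obtain ⟨ε₁, hε₁, H1⟩ := lintegral_sub_conv_mul_le (p := 2) (q := 2) (by simp) hv hg hr2
  obtain ⟨ε₂, hε₂, H2⟩ := lintegral_sub_conv_mul_le (p := 1) (q := ⊤) (by simp) hF' h1 hr2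
  obtain ⟨ε, hε, hε'⟩ := exists_between (show 0 < min (min ε₁ ε₂) T by positivity)
  simp only [lt_min_iff] at hε'
  set m := (Iio ε).indicator ℓ with hm
  set q := (Ici ε).indicator ℓ with hq
  have hℓi := hℓ.isKernel.integrableOn T
  have hmi : IntegrableOn m (Ioo 0 T) := Integrable.indicator hℓi measurableSet_Iio
  have hqi : IntegrableOn q (Ioo 0 T) := Integrable.indicator hℓi measurableSet_Ici
  have hmpos := integral_head_pos hℓ hε hε'.2
  set c := (∫ s in Ioo 0 T, m s)⁻¹ with hc
  have hcpos : 0 < c := inv_pos.2 hmpos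
  have hcmi : IntegrableOn (fun s => c * m s) (Ioo 0 T) := hmi.const_mul c
  have hcm0 : ∀ s ∈ Ioo 0 T, 0 ≤ c * m s := fun s hs => mul_nonneg hcpos.le
    (indicator_apply_nonneg fun _ => hℓ.isKernel.nonneg _ hs.1)
  have hcms : ∀ ε₀, ε < ε₀ → ∀ s ∈ Ioo 0 T, ε₀ ≤ s → c * m s = 0 := fun ε₀ h s _ hs => by
    rw [hm, indicator_of_notMem (by simpa using h.le.trans hs), mul_zero]
  have hcm1 : ∫ s in Ioo 0 T, c * m s = 1 := by
    rw [integral_const_mul, hc, inv_mul_cancel₀ hmpos.ne']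
  have A1 := H1 _ hcmi hcm0 (hcms ε₁ hε'.1.1) hcm1
  have A2 := H2 _ hcmi hcm0 (hcms ε₂ hε'.1.2) hcm1
  -- One constant dominating both pairings: `v` with `g` in `(2,2)`, and `F` with `1` in `(1,∞)`.
  let C : ℝ≥0∞ := eLpNorm v 2 (volume.restrict (Ioo 0 T)) * eLpNorm g 2 (volume.restrict (Ioo 0 T))
    + eLpNorm F 1 (volume.restrict (Ioo 0 T)) *
      eLpNorm (fun _ : ℝ => (1 : ℝ)) ⊤ (volume.restrict (Ioo 0 T))
  have hC : C < ⊤ := ENNReal.add_lt_top.2 ⟨ENNReal.mul_lt_top hv.2 hg.2, ENNReal.mul_lt_top hF'.2 h1.2⟩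
  -- The tolerance for `q - ρ_δ * q` must absorb `c`, which is already fixed by `ε`; hence `δ` comes
  -- after `ε`.
  obtain ⟨r', hr', hr'2⟩ : ∃ r' : ℝ≥0∞, 0 < r' ∧ ‖c‖ₑ * r' * C ≤ r / 2 := by
    have hlim : Tendsto (fun r' : ℝ≥0∞ => ‖c‖ₑ * r' * C) (𝓝[>] 0) (𝓝 (‖c‖ₑ * 0 * C)) := by
      refine Tendsto.mono_left ?_ nhdsWithin_le_nhds
      exact ENNReal.Tendsto.mul_const
        (ENNReal.Tendsto.const_mul tendsto_id (Or.inr enorm_ne_top)) (Or.inr hC.ne)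
    rw [mul_zero, zero_mul] at hlim
    obtain ⟨r', h2, h3⟩ := ((hlim.eventually_lt_const hr2).and self_mem_nhdsWithin).exists
    exact ⟨r', h3, h2.le⟩
  obtain ⟨δ₀, hδ₀, H3⟩ := lintegral_sub_conv_mul_le (p := 1) (q := ⊤) (by simp)
    (memLp_one_iff_integrable.2 hqi) h1 hr'
  obtain ⟨δ, hδ, hδ'⟩ := exists_between (show 0 < min δ₀ T by positivity)
  simp only [lt_min_iff] at hδ'
  have A3 := H3 (box δ) (integrableOn_box δ T) (fun s _ => box_nonneg hδ s)
    (fun s _ hs => indicator_of_notMem (by simpa using hδ'.1.trans_le hs) _)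
    (integral_box_eq hδ hδ'.2)
  refine ⟨ε, δ, c, hδ, hcpos, ?_⟩
  rintro κ hκ
  have hbq := integrableOn_conv (integrableOn_box δ T) hqi
  let θ : ℝ → ℝ := fun s => c * (q s - conv (box δ) q s)
  have hθi : IntegrableOn θ (Ioo 0 T) := (hqi.sub hbq).const_mul c
  have hθ1 : ∫⁻ s in Ioo 0 T, ‖θ s‖ₑ ≤ ‖c‖ₑ * r' := by
    simp only [θ, enorm_mul]
    rw [lintegral_const_mul' _ _ (by simp)]
    refine mul_le_mul_right ?_ _
    simpa using A3
  have hcκ : (fun s => c * κ s) = fun s => c * m s + θ s := by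
    ext s
    simp only [hκ, θ, hm]
    by_cases hs : s < ε
    · rw [hq, indicator_of_mem (mem_Iio.2 hs), indicator_of_notMem (by simpa using hs)]; ring
    · rw [hq, indicator_of_notMem (by simpa using hs), indicator_of_mem (by simpa using hs)]; ring
  have hest : ∀ x ≤ C, (∫⁻ s in Ioo 0 T, ‖θ s‖ₑ) * x ≤ r / 2 := fun x hx =>
    (mul_le_mul' hθ1 hx).trans hr'2
  have hv' := (lintegral_sub_conv_add_mul_le (p := 2) (q := 2) hcmi hθi hv hg.1).trans
    (add_le_add A1 (hest _ le_self_add))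
  have hFbound := (lintegral_sub_conv_add_mul_le (p := 1) (q := ⊤) hcmi hθi hF' h1.1).trans
    (add_le_add A2 (hest _ le_add_self))
  rw [ENNReal.add_halves, ← hcκ] at hv' hFbound
  simp only [conv_const_mul_left] at hv' hFbound
  exact ⟨hv', by simpa using hFbound⟩

/-- If `w = ℓ * v` and `g` is a subgradient of `F` along `w` (also relative to the value `0` at the
origin), then `F ≤ ℓ * (v, g)`. -/
lemma le_conv_inner (hk : IsKernel k) (hℓ : IsConjugateKernel k ℓ) (hT : 0 < T)
    {P : ℝ → Prop} (hP : ∀ᵐ t ∂(volume.restrict (Ioo 0 T)), P t)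
    (hF : ∀ t, P t → F t ≤ inner ℝ (w t) (g t))
    (hFF : ∀ t s, P t → P s → F t - F s ≤ inner ℝ (w t - w s) (g t))
    (hFi : IntegrableOn F (Ioo 0 T)) (hwi : IntegrableOn w (Ioo 0 T))
    (hv : MemL2 T v) (hg : MemL2 T g)
    (hwv : w =ᵐ[volume.restrict (Ioo 0 T)] conv ℓ v) :
    ∀ᵐ t ∂(volume.restrict (Ioo 0 T)), F t ≤ conv ℓ (fun s => inner ℝ (v s) (g s)) t := by
  have hℓi := hℓ.isKernel.integrableOn T
  have hp := integrableOn_inner hv hg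
  set p : ℝ → ℝ := fun s => inner ℝ (v s) (g s) with hpdef
  have h1 : MemLp (fun _ : ℝ => (1 : ℝ)) ⊤ (volume.restrict (Ioo 0 T)) := memLp_top_const 1
  set A : ℝ≥0∞ := (∫⁻ s in Ioo 0 T, ‖ℓ s‖ₑ) *
    eLpNorm (fun _ : ℝ => (1 : ℝ)) ⊤ (volume.restrict (Ioo 0 T)) with hA
  have hAtop : A < ⊤ := ENNReal.mul_lt_top hℓi.2 h1.2
  -- The positive part of `F - ℓ * p` is shown to have arbitrarily small integral, so the limit
  -- needs no a.e. convergent subsequence.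
  have key : ∀ r : ℝ≥0∞, 0 < r →
      ∫⁻ t in Ioo 0 T, ENNReal.ofReal (F t - conv ℓ p t) ≤ A * r + r := by
    intro r hr
    obtain ⟨ε, δ, c, hδ, hc, hκ⟩ := exists_approximate_identity hℓ hT hFi hv hg hr
    obtain ⟨hr1, hr2⟩ := hκ _ rfl
    set κ : ℝ → ℝ := fun s => ℓ s - conv (box δ) ((Ici ε).indicator ℓ) s with hκdef
    have hκi : IntegrableOn κ (Ioo 0 T) := hℓi.sub
      (integrableOn_conv (integrableOn_box δ T) (Integrable.indicator hℓi measurableSet_Ici))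
    set e : ℝ → ℝ := fun s => c * inner ℝ (conv κ v s) (g s) with hedef
    have hei : IntegrableOn e (Ioo 0 T) := (integrableOn_inner_conv hκi hv hg).const_mul c
    have hpe : IntegrableOn (fun s => p s - e s) (Ioo 0 T) := hp.sub hei
    have hnorm : eLpNorm (fun s => p s - e s) 1 (volume.restrict (Ioo 0 T)) ≤ r := by
      rw [eLpNorm_one_eq_lintegral_enorm]
      refine (lintegral_mono fun t => ?_).trans hr1
      have : p t - e t = inner ℝ (v t - c • conv κ v t) (g t) := by
        rw [inner_sub_left, real_inner_smul_left]
      rw [this]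
      exact enorm_inner_le _ _
    have hcomp := conv_le_conv_inner hk hℓ hP hF hFF hFi hwi hv hg hwv hδ hκdef
    calc _ ≤ ∫⁻ t in Ioo 0 T, (‖conv ℓ (fun s => p s - e s) t‖ₑ * ‖(1 : ℝ)‖ₑ
            + ‖F t - c * conv κ F t‖ₑ) := by
          refine lintegral_mono_ae ?_
          filter_upwards [hcomp, conv_sub_right hℓi hp hei] with t h2 h3
          have h4 : conv ℓ e t = c * conv ℓ (fun s => inner ℝ (conv κ v s) (g s)) t :=
            conv_const_mul_right _ _ _ _
          have h5 := mul_le_mul_of_nonneg_left h2 hc.le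
          -- `F - ℓ * p = (F - c κ * F) + (c κ * F - ℓ * e) - ℓ * (p - e)`, and the middle term is
          -- nonpositive.
          have h6 : F t - conv ℓ p t ≤
              |conv ℓ (fun s => p s - e s) t| + |F t - c * conv κ F t| := by
            have := neg_abs_le (conv ℓ (fun s => p s - e s) t)
            have := le_abs_self (F t - c * conv κ F t)
            linarith
          refine (ENNReal.ofReal_le_ofReal h6).trans ?_
          rw [ENNReal.ofReal_add (abs_nonneg _) (abs_nonneg _)]
          simp [Real.enorm_eq_ofReal_abs]
      _ = (∫⁻ t in Ioo 0 T, ‖conv ℓ (fun s => p s - e s) t‖ₑ * ‖(1 : ℝ)‖ₑ)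
            + ∫⁻ t in Ioo 0 T, ‖F t - c * conv κ F t‖ₑ :=
          lintegral_add_left' ((integrableOn_conv hℓi hpe).1.enorm.mul_const _) _
      _ ≤ A * r + r := by
          refine add_le_add ((lintegral_conv_mul_le (p := 1) (q := ⊤) (G := fun _ => (1 : ℝ)) hℓi
            (memLp_one_iff_integrable.2 hpe) h1.1).trans ?_) hr2
          rw [hA, mul_right_comm, mul_assoc]
          exact mul_le_mul_right (mul_le_mul_left hnorm _) _
  have hzero : ∫⁻ t in Ioo 0 T, ENNReal.ofReal (F t - conv ℓ p t) = 0 := by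
    have hlim : Tendsto (fun r : ℝ≥0∞ => A * r + r) (𝓝[>] 0) (𝓝 (A * 0 + 0)) := by
      refine Tendsto.mono_left ?_ nhdsWithin_le_nhds
      exact (ENNReal.Tendsto.const_mul tendsto_id (Or.inr hAtop.ne)).add tendsto_id
    rw [mul_zero, add_zero] at hlim
    exact le_antisymm (ge_of_tendsto hlim (by
      filter_upwards [self_mem_nhdsWithin] with r hr using key r hr)) bot_le
  have hmeas : AEMeasurable (fun t => ENNReal.ofReal (F t - conv ℓ p t))
      (volume.restrict (Ioo 0 T)) :=
    (hFi.sub (integrableOn_conv hℓi hp)).1.aemeasurable.ennreal_ofReal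
  rw [lintegral_eq_zero_iff' hmeas] at hzero
  filter_upwards [hzero] with t ht
  have : F t - conv ℓ p t ≤ 0 := by simpa using ht
  linarith

end ChainRule

/-! ### Integrability of `φ(u)` and inversion of the fractional derivative. -/

section Subdifferential

open Filter

variable {H : Type*} [NormedAddCommGroup H] [InnerProductSpace ℝ H]

lemma IsProperLscConvex.coe_toReal {φ : H → EReal} (hφ : IsProperLscConvex φ) {z : H}
    (hz : z ∈ effDom φ) : ((φ z).toReal : EReal) = φ z :=
  EReal.coe_toReal (ne_of_lt hz) (hφ.ne_bot z)

lemma IsProperLscConvex.toReal_sub_le_inner {φ : H → EReal} (hφ : IsProperLscConvex φ) {z y ξ : H}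
    (hξ : ξ ∈ subdiff φ z) (hy : y ∈ effDom φ) :
    (φ z).toReal - (φ y).toReal ≤ inner ℝ (z - y) ξ := by
  have h := hξ.2 y hy
  rw [← hφ.coe_toReal hy, ← hφ.coe_toReal hξ.1, ← EReal.coe_sub, EReal.coe_le_coe_iff] at h
  rw [← neg_sub y z, inner_neg_left, real_inner_comm]
  linarith

/-- For one good time `t₁`, the subgradient at `u t₁` bounds `φ(u)` below by an affine function of
`u`. The subgradients `g t` bound it above by `φ(u t₁) + (u - u t₁, g)`. Both bounds are integrable,
and lower semicontinuity gives measurability. -/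
lemma IsProperLscConvex.integrableOn_toReal {φ : H → EReal} (hφ : IsProperLscConvex φ) {T : ℝ}
    (hT : 0 < T) {u g : ℝ → H} (hu : MemL2 T u) (hg : MemL2 T g)
    (hgu : ∀ᵐ t ∂(volume.restrict (Ioo 0 T)), g t ∈ subdiff φ (u t)) :
    IntegrableOn (fun t => (φ (u t)).toReal) (Ioo 0 T) := by
  have : NeBot (ae (volume.restrict (Ioo 0 T))) := by
    rw [ae_neBot, Ne, Measure.restrict_eq_zero]
    simp [hT]
  obtain ⟨t₁, ht₁⟩ := hgu.exists
  have hmeas : AEStronglyMeasurable (fun t => (φ (u t)).toReal) (volume.restrict (Ioo 0 T)) := by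
    borelize H
    exact ((measurable_ereal_toReal.comp hφ.lsc.measurable).comp_aemeasurable
      hu.1.aemeasurable).aestronglyMeasurable
  have hsub : MemL2 T fun t => u t - u t₁ := hu.sub (memLp_const _)
  have hlow : IntegrableOn (fun t => (φ (u t₁)).toReal - inner ℝ (u t₁ - u t) (g t₁)) (Ioo 0 T) := by
    refine (integrable_const _).sub ?_
    exact ((integrable_const (u t₁)).sub (hu.integrable one_le_two)).inner_const (g t₁)
  have hup : IntegrableOn (fun t => (φ (u t₁)).toReal + inner ℝ (u t - u t₁) (g t)) (Ioo 0 T) :=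
    (integrable_const _).add (integrableOn_inner hsub hg)
  refine integrable_of_le_of_le hmeas ?_ ?_ hlow hup
  · filter_upwards [hgu] with t ht
    linarith [hφ.toReal_sub_le_inner ht₁ ht.1]
  · filter_upwards [hgu] with t ht
    linarith [hφ.toReal_sub_le_inner ht ht₁.1]

/-- Inversion of the fractional derivative: `u - u₀ = ℓ * d/dt[k * (u - u₀)]`. -/
lemma ae_eq_conv_conjugate [CompleteSpace H] {k ℓ : ℝ → ℝ} (hk : IsKernel k)
    (hℓ : IsConjugateKernel k ℓ) {T : ℝ} {w v : ℝ → H} (hw : IntegrableOn w (Ioo 0 T))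
    (hv : IntegrableOn v (Ioo 0 T)) (hwv : IsWeakDeriv T (conv k w) v)
    (h0 : VanishesAtZero T (conv k w)) :
    w =ᵐ[volume.restrict (Ioo 0 T)] conv ℓ v := by
  have hkT := hk.integrableOn T
  have hℓT := hℓ.isKernel.integrableOn T
  have h1T : IntegrableOn (fun _ : ℝ => (1 : ℝ)) (Ioo 0 T) := integrableOn_const (by simp)
  -- `1 * w = ℓ * (k * w) = ℓ * (1 * v) = 1 * (ℓ * v)`; then the primitives are differentiated.
  refine ae_eq_of_conv_one_ae_eq hw (integrableOn_conv hℓT hv) ?_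
  have h1 : (fun _ => 1 : ℝ → ℝ) =ᵐ[volume.restrict (Ioo 0 T)] conv ℓ k := by
    filter_upwards [ae_restrict_mem measurableSet_Ioo] with t ht
    rw [conv_comm, hℓ.conv_eq_one t ht.1]
  exact (conv_ae_congr h1 (ae_eq_refl w)).trans <| (conv_assoc hℓT hkT hw).trans <|
    (conv_ae_congr (ae_eq_refl ℓ) (ae_eq_conv_one_of_weakDeriv hwv h0 hv)).trans
      (conv_left_comm hℓT h1T hv)

end Subdifferential

end FracFlow

/-! ### The chain-rule inequalities. -/

open FracFlow in
theorem proposition4p2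
    {H : Type*} [NormedAddCommGroup H] [InnerProductSpace ℝ H] [CompleteSpace H]
    (k : ℝ → ℝ) (hk : FracFlow.AssumptionK k)
    (φ : H → EReal) (hφ : FracFlow.IsProperLscConvex φ)
    (T : ℝ) (hT : 0 < T)
    (u₀ : H) (hu₀ : u₀ ∈ FracFlow.effDom φ)
    (u : ℝ → H) (hu : FracFlow.MemL2 T u)
    -- `v` is the time-derivative of `k * (u - u₀)`
    (v : ℝ → H)
    (hW : FracFlow.IsW12WithDeriv T (FracFlow.conv k (fun s => u s - u₀)) v)
    (h0 : FracFlow.VanishesAtZero T (FracFlow.conv k (fun s => u s - u₀)))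
    (hdom : ∀ᵐ t ∂(volume.restrict (Ioo 0 T)), u t ∈ FracFlow.subdiffDom φ)
    (g : ℝ → H) (hg : FracFlow.MemL2 T g)
    (hgu : ∀ᵐ t ∂(volume.restrict (Ioo 0 T)), g t ∈ FracFlow.subdiff φ (u t)) :
    -- all the integrals below make sense
    IntegrableOn (fun t => (φ (u t)).toReal) (Ioo 0 T) ∧
    IntegrableOn (fun t => (inner ℝ (v t) (g t) : ℝ)) (Ioo 0 T) ∧
    -- (i)
    (∀ᵐ t ∂(volume.restrict (Ioo 0 T)),
      FracFlow.ConvExists k (fun s => (φ (u s)).toReal - (φ u₀).toReal) t ∧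
      FracFlow.conv k (fun s => (φ (u s)).toReal - (φ u₀).toReal) t
        ≤ ∫ τ in (0 : ℝ)..t, (inner ℝ (v τ) (g τ) : ℝ)) ∧
    -- (ii)
    (∀ ℓ : ℝ → ℝ, FracFlow.IsConjugateKernel k ℓ →
      ∀ᵐ t ∂(volume.restrict (Ioo 0 T)),
        FracFlow.ConvExists ℓ (fun s => (inner ℝ (v s) (g s) : ℝ)) t ∧
        φ (u t) - φ u₀
          ≤ ((FracFlow.conv ℓ (fun s => (inner ℝ (v s) (g s) : ℝ)) t : ℝ) : EReal)) := by
  obtain ⟨hkk, ℓ₀, hℓ₀⟩ := hk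
  have hφu := hφ.integrableOn_toReal hT hu hg hgu
  have hp := integrableOn_inner hW.memL2_deriv hg
  have hFi : IntegrableOn (fun s => (φ (u s)).toReal - (φ u₀).toReal) (Ioo 0 T) :=
    hφu.sub (integrable_const _)
  have hwi : IntegrableOn (fun s => u s - u₀) (Ioo 0 T) :=
    (hu.integrable one_le_two).sub (integrable_const _)
  have hvi : IntegrableOn v (Ioo 0 T) := hW.memL2_deriv.integrable one_le_two
  have main : ∀ ℓ, IsConjugateKernel k ℓ → ∀ᵐ t ∂(volume.restrict (Ioo 0 T)),
      (φ (u t)).toReal - (φ u₀).toReal ≤ conv ℓ (fun s => inner ℝ (v s) (g s)) t := by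
    intro ℓ hℓ
    -- The good times are those with `g t ∈ ∂φ(u t)`; there the inequalities hold for every pair of
    -- times, with no null set in the product.
    refine le_conv_inner hkk hℓ hT hgu (w := fun s => u s - u₀) (fun t ht => ?_)
      (fun t s ht hs => ?_) hFi hwi hW.memL2_deriv hg
      (ae_eq_conv_conjugate hkk hℓ hwi hvi hW.weakDeriv h0)
    · exact hφ.toReal_sub_le_inner ht hu₀
    · rw [sub_sub_sub_cancel_right, sub_sub_sub_cancel_right]
      exact hφ.toReal_sub_le_inner ht hs.1
  have hkT := hkk.integrableOn T
  have hℓT := hℓ₀.isKernel.integrableOn T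
  refine ⟨hφu, hp, ?_, fun ℓ hℓ => ?_⟩
  -- Part (i) is (ii) for `ℓ₀` convolved with `k`, since `k * (ℓ₀ * p) = 1 * p`.
  · have h1 : conv k ℓ₀ =ᵐ[volume.restrict (Ioo 0 T)] fun _ => 1 := by
      filter_upwards [ae_restrict_mem measurableSet_Ioo] with t ht using hℓ₀.conv_eq_one t ht.1
    have h2 := conv_mono hkT hFi (integrableOn_conv hℓT hp)
      ((ae_restrict_mem measurableSet_Ioo).mono fun s hs => hkk.nonneg s hs.1) (main ℓ₀ hℓ₀)
    filter_upwards [ae_convExists hkT hFi, h2, conv_assoc hkT hℓT hp,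
      conv_ae_congr h1 (ae_eq_refl fun s => (inner ℝ (v s) (g s) : ℝ))] with t h3 h4 h5 h6
    refine ⟨h3, h4.trans_eq ?_⟩
    rw [← h5, h6, conv_one_left]
  · filter_upwards [ae_convExists (hℓ.isKernel.integrableOn T) hp, main ℓ hℓ, hgu] with t h1 h2 h3
    refine ⟨h1, ?_⟩
    rw [← hφ.coe_toReal h3.1, ← hφ.coe_toReal hu₀, ← EReal.coe_sub, EReal.coe_le_coe_iff]
    exact h2

end
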